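/- Let $\mathcal C$ be the set of all closed subsets of $\mathbb R$ with the Effros $\sigma$-field $\mathcal B$ (generated by the sets $\{C : C\cap U\neq\emptyset\}$, $U\subset\mathbb R$ open). An equivalence class of measures $\mathcal M$ on $(\mathcal C,\mathcal B)$ is a nonempty set of finite positive measures consisting, for some (hence every) $\mu\in\mathcal M$, of exactly those finite positive measures that are mutually absolutely continuous with $\mu$. It is called decomposable if (a) for every $s\in\mathbb R$ the sub-$\sigma$-fields generated by $C\mapsto C\cap(-\infty,s]$ and by $C\mapsto C\cap[s,\infty)$ are independent with respect to some probability measure $\mu\in\mathcal M$ (which may depend on $s$); (b) for every $t\in\mathbb R$ the set $\{C : t\in C\}$ is $\mathcal M$-negligible. For $0\le s<t\le1$ let $\mathcal M_{s,t}$ consist of the images of the measures $\mu\in\mathcal M$ under $C\mapsto C\cap[s,t]$, and let $H_{s,t}=L_2(\mathcal M_{s,t})$ be the (real or complex) Hilbert space of families $(\psi_\mu)_{\mu\in\mathcal M_{s,t}}$ with $\psi_\mu\in L_2(\mu)$ and $\psi_\nu=\sqrt{d\mu/d\nu}\,\psi_\mu$; write $f\sqrt\mu$ for the family whose member at $\mu$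 is $f$. If $\mathcal M$ is decomposable, the map $(C_1,C_2)\mapsto C_1\cup C_2$ identifies $\mathcal M_{r,s}\times\mathcal M_{s,t}$ with $\mathcal M_{r,t}$ for $r<s<t$. Together with the resulting unitary operators $H_{r,s}\otimes H_{s,t}\to H_{r,t}$, $f\sqrt\mu\otimes g\sqrt\nu\mapsto (f\otimes g)\sqrt{\mu\times\nu}$, the spaces $H_{s,t}$ form a continuous product of Hilbert spaces over $[0,1]$. A decomposable vector is a $\psi\in H_{0,1}$, $\psi\ne0$, such that for every $t\in(0,1)$ it has the form $\psi=\psi'\otimes\psi''$ with $\psi'\in H_{0,t}$, $\psi''\in H_{t,1}$. The continuous product is of type $I$ if the decomposable vectors span $H_{0,1}$ as a closed linear space, of type $III$ if there are none, of type $II$ if it is of neither type $I$ nor type $III$, and of type $II_0$ if it is of type $II$ and all decomposable vectors lie in a single one-dimensional subspace of $H_{0,1}$. **Lemma 5.8.** Let $\mathcal M$ be a decomposable equivalence class of measures on $\mathcal C$ such that almost all $C\in\mathcal C$ are perfect (closed without isolated points; the empty set is perfect). Then the corresponding continuous product of Hilbert spaces over $[0,1]$ is of type $II_0$, unless $C\cap[0,1]=\emptyset$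 for almost all $C\in\mathcal C$. -/

import Mathlib

open MeasureTheory TopologicalSpace
open scoped ENNReal

/-- A measure class on `X`: a nonempty set of finite positive measures consisting exactly of the
finite measures that are mutually absolutely continuous with some (equivalently, any) one of its
members. -/
structure MeasureClass (X : Type*) [MeasurableSpace X] where
  carrier : Set (Measure X)
  nonempty : carrier.Nonempty
  isFinite : ∀ μ ∈ carrier, IsFiniteMeasure μ
  mem_iff : ∀ μ ∈ carrier, ∀ ν : Measure X, IsFiniteMeasure ν → (ν ∈ carrier ↔ ν ≪ μ ∧ μ ≪ ν)

namespace MeasureClass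

section Basic

variable {X : Type*} [MeasurableSpace X] {M : MeasureClass X}

instance : CoeSort (MeasureClass X) (Type _) := ⟨fun M => {μ : Measure X // μ ∈ M.carrier}⟩

instance (μ : M) : IsFiniteMeasure (μ : Measure X) := M.isFinite _ μ.2

instance : Nonempty M := let ⟨μ, h⟩ := M.nonempty; ⟨⟨μ, h⟩⟩

theorem ac (μ ν : M) : (μ : Measure X) ≪ ν :=
  ((M.mem_iff ν ν.2 μ inferInstance).1 μ.2).1

/-- `P` holds almost everywhere: its complement is negligible for (every member of) `M`. -/
def AE (M : MeasureClass X) (P : X → Prop) : Prop := ∀ μ ∈ M.carrier, ∀ᵐ x ∂μ, P x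

/-- Independence of two sub-σ-fields on a measure class: they are independent under some
probability measure of the class. (Completing the sub-σ-fields by negligible sets does not affect
this.) -/
def Indep (m₁ m₂ : MeasurableSpace X) {mX : MeasurableSpace X} (M : MeasureClass X) : Prop :=
  ∃ μ ∈ M.carrier, IsProbabilityMeasure μ ∧ ProbabilityTheory.Indep m₁ m₂ μ

theorem map_withDensity_comp {Y : Type*} [MeasurableSpace Y] (μ : Measure X) {p : X → Y}
    (hp : Measurable p) {g : Y → ℝ≥0∞} (hg : Measurable g) :
    (μ.withDensity (g ∘ p)).map p = (μ.map p).withDensity g := by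
  ext s hs
  rw [Measure.map_apply hp hs, withDensity_apply _ (hp hs), withDensity_apply _ hs,
    setLIntegral_map hs hg hp]
  rfl

/-- The image of a measure class under a measurable map (the quotient measure class by the
sub-σ-field generated by the map): it consists of the images of the members. -/
def map {Y : Type*} [MeasurableSpace Y] (M : MeasureClass X) (p : X → Y) (hp : Measurable p) :
    MeasureClass Y where
  carrier := {ν | ∃ μ ∈ M.carrier, ν = μ.map p}
  nonempty := let ⟨μ, h⟩ := M.nonempty; ⟨_, μ, h, rfl⟩
  isFinite := by
    rintro _ ⟨μ, h, rfl⟩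
    have := M.isFinite μ h
    infer_instance
  mem_iff := by
    rintro _ ⟨μ, h, rfl⟩ ν hν
    have hμ := M.isFinite μ h
    constructor
    · rintro ⟨μ', h', rfl⟩
      exact ⟨(M.ac ⟨μ', h'⟩ ⟨μ, h⟩).map hp, (M.ac ⟨μ, h⟩ ⟨μ', h'⟩).map hp⟩
    · rintro ⟨h1, h2⟩
      set g := ν.rnDeriv (μ.map p)
      have hg : Measurable g := Measure.measurable_rnDeriv _ _
      have hm : (μ.withDensity (g ∘ p)).map p = ν := by
        rw [map_withDensity_comp μ hp hg, Measure.withDensity_rnDeriv_eq _ _ h1]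
      have hfin : IsFiniteMeasure (μ.withDensity (g ∘ p)) := by
        constructor
        rw [← Set.preimage_univ (f := p), ← Measure.map_apply hp MeasurableSet.univ, hm]
        exact measure_lt_top _ _
      refine ⟨_, ?_, hm.symm⟩
      refine (M.mem_iff μ h _ hfin).2 ⟨withDensity_absolutelyContinuous _ _, ?_⟩
      refine withDensity_absolutelyContinuous' (hg.comp hp).aemeasurable ?_
      have := Measure.rnDeriv_pos' h2
      filter_upwards [ae_of_ae_map hp.aemeasurable this] with x hx using hx.ne'

theorem map_mem {Y : Type*} [MeasurableSpace Y] (p : X → Y) (hp : Measurable p) {μ : Measure X}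
    (hμ : μ ∈ M.carrier) : μ.map p ∈ (M.map p hp).carrier := ⟨μ, hμ, rfl⟩

end Basic

section Transfer

variable {𝕜 : Type*} [RCLike 𝕜] {X : Type*} [MeasurableSpace X]

/-- The function `√(dμ/dν) f`. -/
noncomputable def transfer (μ ν : Measure X) (f : X → 𝕜) (x : X) : 𝕜 :=
  ((Real.sqrt (μ.rnDeriv ν x).toReal : ℝ) : 𝕜) * f x

theorem transfer_congr {μ ν : Measure X} (h : ν ≪ μ) {f g : X → 𝕜} (hfg : f =ᵐ[μ] g) :
    transfer μ ν f =ᵐ[ν] transfer μ ν g := by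
  filter_upwards [h.ae_eq hfg] with x hx
  simp [transfer, hx]

theorem transfer_add (μ ν : Measure X) (f g : X → 𝕜) :
    transfer μ ν (f + g) = transfer μ ν f + transfer μ ν g := by
  ext x; simp [transfer, mul_add]

theorem transfer_smul (μ ν : Measure X) (c : 𝕜) (f : X → 𝕜) :
    transfer μ ν (c • f) = c • transfer μ ν f := by
  ext x; simp [transfer]; ring

theorem transfer_self (μ : Measure X) [SigmaFinite μ] (f : X → 𝕜) : transfer μ μ f =ᵐ[μ] f := by
  filter_upwards [μ.rnDeriv_self] with x hx
  simp [transfer, hx]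

theorem transfer_trans {μ ν κ : Measure X} [SigmaFinite μ] [SigmaFinite ν] [SigmaFinite κ]
    (h : μ ≪ ν) (f : X → 𝕜) :
    transfer ν κ (transfer μ ν f) =ᵐ[κ] transfer μ κ f := by
  filter_upwards [Measure.rnDeriv_mul_rnDeriv h (κ := κ)] with x hx
  simp only [transfer, ← hx, Pi.mul_apply, ENNReal.toReal_mul,
    Real.sqrt_mul ENNReal.toReal_nonneg]
  push_cast
  ring

theorem transfer_mul_conj (μ ν : Measure X) (f g : X → 𝕜) (x : X) :
    inner 𝕜 (transfer μ ν f x) (transfer μ ν g x)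
      = (μ.rnDeriv ν x).toReal • inner 𝕜 (f x) (g x) := by
  have h : ((Real.sqrt (μ.rnDeriv ν x).toReal : ℝ) : 𝕜) *
      ((Real.sqrt (μ.rnDeriv ν x).toReal : ℝ) : 𝕜) = (((μ.rnDeriv ν x).toReal : ℝ) : 𝕜) := by
    rw [← RCLike.ofReal_mul, Real.mul_self_sqrt ENNReal.toReal_nonneg]
  simp only [transfer, RCLike.inner_apply, map_mul, RCLike.conj_ofReal, RCLike.real_smul_eq_coe_mul,
    ← h]
  ring

theorem transfer_memLp {μ ν : Measure X} [SigmaFinite μ] [SigmaFinite ν] (h : μ ≪ ν)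
    (h' : ν ≪ μ) {f : X → 𝕜} (hf : MemLp f 2 μ) : MemLp (transfer μ ν f) 2 ν := by
  have hm : AEStronglyMeasurable (transfer μ ν f) ν := by
    refine AEStronglyMeasurable.mul ?_ (hf.1.mono_ac h')
    have : Measurable fun x => ((Real.sqrt (μ.rnDeriv ν x).toReal : ℝ) : 𝕜) :=
      RCLike.measurable_ofReal.comp
        ((μ.measurable_rnDeriv ν).ennreal_toReal.sqrt)
    exact this.aestronglyMeasurable
  rw [memLp_two_iff_integrable_sq_norm hm]
  have h2 := (memLp_two_iff_integrable_sq_norm hf.1).1 hf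
  refine ((integrable_rnDeriv_smul_iff h).2 h2).congr (Filter.Eventually.of_forall fun x => ?_)
  simp only [transfer, norm_mul, mul_pow, RCLike.norm_ofReal, smul_eq_mul, sq_abs,
    Real.sq_sqrt ENNReal.toReal_nonneg]

theorem integral_transfer {μ ν : Measure X} [SigmaFinite μ] [SigmaFinite ν] (h : μ ≪ ν)
    (f g : X → 𝕜) :
    ∫ x, inner 𝕜 (transfer μ ν f x) (transfer μ ν g x) ∂ν = ∫ x, inner 𝕜 (f x) (g x) ∂μ := by
  simp only [transfer_mul_conj]
  exact integral_rnDeriv_smul h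

end Transfer

section HalfDensities

variable (𝕜 : Type*) [RCLike 𝕜] {X : Type*} [MeasurableSpace X] (M : MeasureClass X)

/-- The families `(ψ_μ)`, `μ ∈ M`, with `ψ_μ ∈ L₂(μ)` and `ψ_ν = √(dμ/dν) ψ_μ` for all
`μ, ν ∈ M`. -/
noncomputable def halfDensities : Submodule 𝕜 (∀ μ : M, Lp 𝕜 2 (μ : Measure X)) where
  carrier := {ψ | ∀ μ ν : M, ψ ν =ᵐ[(ν : Measure X)] transfer (μ : Measure X) ν (ψ μ)}
  zero_mem' μ ν := by
    filter_upwards [Lp.coeFn_zero 𝕜 2 (ν : Measure X),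
      transfer_congr (M.ac ν μ) (Lp.coeFn_zero 𝕜 2 (μ : Measure X))] with x h1 h2
    simp only [Pi.zero_apply] at h1 h2 ⊢
    rw [h1, h2]; simp [transfer]
  add_mem' {a b} ha hb μ ν := by
    filter_upwards [Lp.coeFn_add (a ν) (b ν), ha μ ν, hb μ ν,
      transfer_congr (M.ac ν μ) (Lp.coeFn_add (a μ) (b μ))] with x h1 h2 h3 h4
    rw [Pi.add_apply] at h1
    simp only [Pi.add_apply] at h4 ⊢
    rw [h1, h4, transfer_add, Pi.add_apply, h2, h3]
  smul_mem' c a ha μ ν := by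
    filter_upwards [Lp.coeFn_smul c (a ν), ha μ ν,
      transfer_congr (M.ac ν μ) (Lp.coeFn_smul c (a μ))] with x h1 h2 h4
    simp only [Pi.smul_apply] at h1 h4 ⊢
    rw [h1, h4, transfer_smul, Pi.smul_apply, h2]

/-- The Hilbert space `L₂(M)` of a measure class (square roots of measures): its elements are the
families `(ψ_μ)`, `μ ∈ M`, with `ψ_μ ∈ L₂(μ)` and `ψ_ν = √(dμ/dν) ψ_μ`. Thus `f√μ` is the
family whose member at `μ` is `f`. -/
def L2 : Type _ := halfDensities 𝕜 M

namespace L2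

noncomputable instance : AddCommGroup (L2 𝕜 M) := inferInstanceAs (AddCommGroup (halfDensities 𝕜 M))
noncomputable instance : Module 𝕜 (L2 𝕜 M) := inferInstanceAs (Module 𝕜 (halfDensities 𝕜 M))

variable {𝕜 M}

/-- The member at `μ` of a family `ψ ∈ L₂(M)`. -/
noncomputable def member (μ : M) : L2 𝕜 M →ₗ[𝕜] Lp 𝕜 2 (μ : Measure X) :=
  (LinearMap.proj μ).comp (halfDensities 𝕜 M).subtype

theorem at_ae (ψ : L2 𝕜 M) (μ ν : M) :
    member ν ψ =ᵐ[(ν : Measure X)] transfer (μ : Measure X) ν (member μ ψ) := ψ.2 μ ν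

theorem at_injective (μ : M) : Function.Injective (member (𝕜 := 𝕜) μ) := by
  intro ψ φ h
  apply Subtype.ext
  funext ν
  apply Lp.ext
  refine (at_ae ψ μ ν).trans ?_
  rw [h]
  exact (at_ae φ μ ν).symm

theorem ext_at {ψ φ : L2 𝕜 M} (μ : M) (h : member μ ψ =ᵐ[(μ : Measure X)] member μ φ) : ψ = φ :=
  at_injective μ (Lp.ext h)

theorem inner_at (ψ φ : L2 𝕜 M) (μ ν : M) :
    inner 𝕜 (member ν ψ) (member ν φ) = inner 𝕜 (member μ ψ) (member μ φ) := by
  rw [MeasureTheory.L2.inner_def, MeasureTheory.L2.inner_def, ← integral_transfer (M.ac μ ν)]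
  refine integral_congr_ae ?_
  filter_upwards [at_ae ψ μ ν, at_ae φ μ ν] with x h1 h2
  rw [h1, h2]

@[reducible] noncomputable def core : InnerProductSpace.Core 𝕜 (L2 𝕜 M) where
  inner ψ φ := inner 𝕜 (member (Classical.arbitrary M) ψ) (member (Classical.arbitrary M) φ)
  conj_inner_symm _ _ := inner_conj_symm _ _
  re_inner_nonneg _ := inner_self_nonneg
  add_left _ _ _ := by simp [inner_add_left]
  smul_left _ _ _ := by simp [inner_smul_left]
  definite ψ h := by
    apply at_injective (Classical.arbitrary M)
    simpa using h

/-- The inner product is `⟪ψ, φ⟫ = ⟪ψ_μ, φ_μ⟫`, for any `μ ∈ M` (see `inner_eq`). -/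
noncomputable instance : NormedAddCommGroup (L2 𝕜 M) :=
  @InnerProductSpace.Core.toNormedAddCommGroup 𝕜 (L2 𝕜 M) _ _ _ core
noncomputable instance : InnerProductSpace 𝕜 (L2 𝕜 M) := .ofCore core.toCore

theorem inner_eq (ψ φ : L2 𝕜 M) (μ : M) : inner 𝕜 ψ φ = inner 𝕜 (member μ ψ) (member μ φ) :=
  inner_at ψ φ _ _

theorem inner_eq_integral (ψ φ : L2 𝕜 M) (μ : M) :
    inner 𝕜 ψ φ = ∫ x, inner 𝕜 (member μ ψ x) (member μ φ x) ∂(μ : Measure X) := by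
  rw [inner_eq ψ φ μ, MeasureTheory.L2.inner_def]

/-- The half-density `f√μ`. -/
noncomputable def mk (μ : M) (f : X → 𝕜) (hf : MemLp f 2 (μ : Measure X)) : L2 𝕜 M :=
  ⟨fun ν => (transfer_memLp (M.ac μ ν) (M.ac ν μ) hf).toLp _, fun ν κ => by
    refine (MemLp.coeFn_toLp (transfer_memLp (M.ac μ κ) (M.ac κ μ) hf)).trans ?_
    refine (transfer_trans (M.ac μ ν) f).symm.trans ?_
    exact transfer_congr (M.ac κ ν) (MemLp.coeFn_toLp _).symm⟩

theorem mk_at (μ : M) (f : X → 𝕜) (hf : MemLp f 2 (μ : Measure X)) (ν : M) :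
    member ν (mk μ f hf) =ᵐ[(ν : Measure X)] transfer (μ : Measure X) ν f :=
  MemLp.coeFn_toLp (transfer_memLp (M.ac μ ν) (M.ac ν μ) hf)

theorem mk_at_self (μ : M) (f : X → 𝕜) (hf : MemLp f 2 (μ : Measure X)) :
    member μ (mk μ f hf) =ᵐ[(μ : Measure X)] f := (mk_at μ f hf μ).trans (transfer_self _ _)

/-- For each `μ ∈ M`, the map `f√μ ↦ f` is a unitary operator from `L₂(M)` onto `L₂(μ)`. -/
noncomputable def equivLp (μ : M) : L2 𝕜 M ≃ₗᵢ[𝕜] Lp 𝕜 2 (μ : Measure X) :=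
  LinearEquiv.isometryOfInner
    (LinearEquiv.ofBijective (member μ) ⟨at_injective μ, fun f =>
      ⟨mk μ f (Lp.memLp f), Lp.ext (mk_at_self μ f _)⟩⟩)
    (fun x y => (inner_eq x y μ).symm)

instance : CompleteSpace (L2 𝕜 M) :=
  (equivLp (𝕜 := 𝕜) (Classical.arbitrary M)).toIsometryEquiv.completeSpace

instance [MeasurableSpace.CountablyGenerated X] : SeparableSpace (L2 𝕜 M) := by
  have := Fact.mk (by simp : (2 : ℝ≥0∞) ≠ ∞)
  exact (equivLp (𝕜 := 𝕜) (Classical.arbitrary M)).toHomeomorph.symm.surjective.denseRange.separableSpace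
    (equivLp (𝕜 := 𝕜) (Classical.arbitrary M)).toHomeomorph.symm.continuous

theorem nontrivial (μ : M) (h : (μ : Measure X) ≠ 0) : Nontrivial (L2 𝕜 M) := by
  refine ⟨mk μ (fun _ => 1) (memLp_const 1), 0, fun h0 => h ?_⟩
  have h1 := mk_at_self μ (fun _ => (1 : 𝕜)) (memLp_const 1)
  rw [h0, map_zero] at h1
  have h2 := (Lp.coeFn_zero 𝕜 2 (μ : Measure X)).symm.trans h1
  rw [← ae_eq_bot, ← Filter.eventually_false_iff_eq_bot]
  filter_upwards [h2] with x hx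
  simp at hx

end L2

end HalfDensities

section Product

variable {X X₁ X₂ : Type*} [MeasurableSpace X] [MeasurableSpace X₁] [MeasurableSpace X₂]

/-- `M` is a product of the measure classes `M₁` and `M₂`: the map `j : X₁ × X₂ → X` is a
mod 0 isomorphism, with inverse `x ↦ (p₁ x, p₂ x)`, of the measure class generated by the products
`μ × ν`, `μ ∈ M₁`, `ν ∈ M₂`, to the measure class `M`. -/
structure IsProduct (M₁ : MeasureClass X₁) (M₂ : MeasureClass X₂) (M : MeasureClass X)
    (p₁ : X → X₁) (p₂ : X → X₂) (j : X₁ × X₂ → X) : Prop where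
  meas₁ : Measurable p₁
  meas₂ : Measurable p₂
  meas : Measurable j
  map_mem : ∀ (μ : M₁) (ν : M₂), ((μ : Measure X₁).prod (ν : Measure X₂)).map j ∈ M.carrier
  left_inv : ∀ (μ : M₁) (ν : M₂), ∀ᵐ z ∂((μ : Measure X₁).prod (ν : Measure X₂)),
    p₁ (j z) = z.1 ∧ p₂ (j z) = z.2
  right_inv : M.AE fun x => j (p₁ x, p₂ x) = x

namespace IsProduct

variable {𝕜 : Type*} [RCLike 𝕜] {M₁ : MeasureClass X₁} {M₂ : MeasureClass X₂} {M : MeasureClass X}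
  {p₁ : X → X₁} {p₂ : X → X₂} {j : X₁ × X₂ → X}

/-- The member `μ × ν` of `M`. -/
noncomputable def pr (h : IsProduct M₁ M₂ M p₁ p₂ j) (μ : M₁) (ν : M₂) : M :=
  ⟨_, h.map_mem μ ν⟩

variable (h : IsProduct M₁ M₂ M p₁ p₂ j)

theorem ae_pr (μ : M₁) (ν : M₂) {P : X₁ → X₂ → Prop}
    (hP : ∀ᵐ z ∂((μ : Measure X₁).prod (ν : Measure X₂)), P z.1 z.2) :
    ∀ᵐ x ∂(h.pr μ ν : Measure X), P (p₁ x) (p₂ x) := by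
  have hae : ∀ᵐ z ∂((μ : Measure X₁).prod (ν : Measure X₂)), P (p₁ (j z)) (p₂ (j z)) := by
    filter_upwards [hP, h.left_inv μ ν] with z h1 h2
    rwa [h2.1, h2.2]
  have hq : (h.pr μ ν : Measure X).map (fun x => (p₁ x, p₂ x))
      = (μ : Measure X₁).prod (ν : Measure X₂) := by
    change (Measure.map j _).map _ = _
    rw [Measure.map_map (h.meas₁.prodMk h.meas₂) h.meas]
    have : ((fun x => (p₁ x, p₂ x)) ∘ j) =ᵐ[(μ : Measure X₁).prod (ν : Measure X₂)] id := by
      filter_upwards [h.left_inv μ ν] with z hz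
      exact Prod.ext hz.1 hz.2
    rw [Measure.map_congr this, Measure.map_id]
  rw [← hq] at hP
  exact ae_of_ae_map (h.meas₁.prodMk h.meas₂).aemeasurable hP

theorem ae₁ (μ : M₁) (ν : M₂) {P : X₁ → Prop} (hP : ∀ᵐ x ∂(μ : Measure X₁), P x) :
    ∀ᵐ x ∂(h.pr μ ν : Measure X), P (p₁ x) :=
  h.ae_pr μ ν (P := fun x _ => P x) (Measure.quasiMeasurePreserving_fst.ae hP)

theorem ae₂ (μ : M₁) (ν : M₂) {P : X₂ → Prop} (hP : ∀ᵐ x ∂(ν : Measure X₂), P x) :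
    ∀ᵐ x ∂(h.pr μ ν : Measure X), P (p₂ x) :=
  h.ae_pr μ ν (P := fun _ x => P x) (Measure.quasiMeasurePreserving_snd.ae hP)

theorem quasi₁ (μ : M₁) (ν : M₂) :
    Measure.QuasiMeasurePreserving p₁ (h.pr μ ν : Measure X) (μ : Measure X₁) :=
  ⟨h.meas₁, Measure.AbsolutelyContinuous.mk fun s hs h0 => by
    rw [Measure.map_apply h.meas₁ hs]
    have := h.ae₁ μ ν (P := fun x => x ∉ s) (measure_eq_zero_iff_ae_notMem.1 h0)
    exact measure_eq_zero_iff_ae_notMem.2 this⟩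

theorem quasi₂ (μ : M₁) (ν : M₂) :
    Measure.QuasiMeasurePreserving p₂ (h.pr μ ν : Measure X) (ν : Measure X₂) :=
  ⟨h.meas₂, Measure.AbsolutelyContinuous.mk fun s hs h0 => by
    rw [Measure.map_apply h.meas₂ hs]
    have := h.ae₂ μ ν (P := fun x => x ∉ s) (measure_eq_zero_iff_ae_notMem.1 h0)
    exact measure_eq_zero_iff_ae_notMem.2 this⟩

theorem memLp_prod_mul {μ : Measure X₁} {ν : Measure X₂} [SFinite μ] [SFinite ν] {f : X₁ → 𝕜}
    {g : X₂ → 𝕜} (hf : MemLp f 2 μ) (hg : MemLp g 2 ν) :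
    MemLp (fun z : X₁ × X₂ => f z.1 * g z.2) 2 (μ.prod ν) := by
  refine (memLp_two_iff_integrable_sq_norm (hf.1.comp_fst.mul hg.1.comp_snd)).2 ?_
  have h1 := (memLp_two_iff_integrable_sq_norm hf.1).1 hf
  have h2 := (memLp_two_iff_integrable_sq_norm hg.1).1 hg
  refine (h1.mul_prod h2).congr (Filter.Eventually.of_forall fun x => ?_)
  simp [mul_pow]

theorem memLp_mul (μ : M₁) (ν : M₂) {f : X₁ → 𝕜} {g : X₂ → 𝕜} (hf : MemLp f 2 (μ : Measure X₁))
    (hg : MemLp g 2 (ν : Measure X₂)) :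
    MemLp (fun x => f (p₁ x) * g (p₂ x)) 2 (h.pr μ ν : Measure X) := by
  refine (memLp_map_measure_iff ?_ h.meas.aemeasurable).2 ?_
  · exact (hf.1.comp_quasiMeasurePreserving (h.quasi₁ μ ν)).mul
      (hg.1.comp_quasiMeasurePreserving (h.quasi₂ μ ν))
  · refine (memLp_congr_ae ?_).1 (memLp_prod_mul hf hg)
    filter_upwards [h.left_inv μ ν] with z hz
    simp [hz.1, hz.2]

theorem rnDeriv_pr (μ μ' : M₁) (ν ν' : M₂) :
    (h.pr μ ν : Measure X).rnDeriv (h.pr μ' ν') =ᵐ[(h.pr μ' ν' : Measure X)]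
      fun x => (μ : Measure X₁).rnDeriv μ' (p₁ x) * (ν : Measure X₂).rnDeriv ν' (p₂ x) := by
  set a := (μ : Measure X₁).rnDeriv μ'
  set b := (ν : Measure X₂).rnDeriv ν'
  have ha : Measurable a := Measure.measurable_rnDeriv _ _
  have hb : Measurable b := Measure.measurable_rnDeriv _ _
  have hg : Measurable fun x => a (p₁ x) * b (p₂ x) :=
    (ha.comp h.meas₁).mul (hb.comp h.meas₂)
  have key : (h.pr μ ν : Measure X) =
      (h.pr μ' ν' : Measure X).withDensity (fun x => a (p₁ x) * b (p₂ x)) := by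
    change Measure.map j _ = (Measure.map j _).withDensity _
    rw [← map_withDensity_comp _ h.meas hg]
    congr 1
    conv_lhs => rw [← Measure.withDensity_rnDeriv_eq _ _ (M₁.ac μ μ'),
      ← Measure.withDensity_rnDeriv_eq _ _ (M₂.ac ν ν'), prod_withDensity ha hb]
    refine withDensity_congr_ae ?_
    filter_upwards [h.left_inv μ' ν'] with z hz
    simp [hz.1, hz.2, a, b]
  conv_lhs => rw [key]
  exact Measure.rnDeriv_withDensity _ hg

theorem transfer_pr (μ μ' : M₁) (ν ν' : M₂) (f : X₁ → 𝕜) (g : X₂ → 𝕜) :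
    transfer (h.pr μ ν : Measure X) (h.pr μ' ν') (fun x => f (p₁ x) * g (p₂ x))
      =ᵐ[(h.pr μ' ν' : Measure X)]
    fun x => transfer (μ : Measure X₁) μ' f (p₁ x) * transfer (ν : Measure X₂) ν' g (p₂ x) := by
  filter_upwards [h.rnDeriv_pr μ μ' ν ν'] with x hx
  simp only [transfer, hx, ENNReal.toReal_mul, Real.sqrt_mul ENNReal.toReal_nonneg]
  push_cast
  ring

/-- The vector `ψ ⊗ φ ∈ L₂(M)`, for `ψ ∈ L₂(M₁)`, `φ ∈ L₂(M₂)`: if `ψ = f√μ` and `φ = g√ν` then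
`ψ ⊗ φ = (f ⊗ g)√(μ × ν)`. The choice of `μ` and `ν` is immaterial, see `tmul_member`. -/
noncomputable def tmul (ψ : L2 𝕜 M₁) (φ : L2 𝕜 M₂) : L2 𝕜 M :=
  L2.mk (h.pr (Classical.arbitrary M₁) (Classical.arbitrary M₂))
    (fun x => L2.member (Classical.arbitrary M₁) ψ (p₁ x) *
      L2.member (Classical.arbitrary M₂) φ (p₂ x))
    (h.memLp_mul _ _ (Lp.memLp _) (Lp.memLp _))

theorem tmul_member (ψ : L2 𝕜 M₁) (φ : L2 𝕜 M₂) (μ : M₁) (ν : M₂) :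
    L2.member (h.pr μ ν) (h.tmul ψ φ) =ᵐ[(h.pr μ ν : Measure X)]
      fun x => L2.member μ ψ (p₁ x) * L2.member ν φ (p₂ x) := by
  refine (L2.mk_at _ _ _ _).trans ((h.transfer_pr _ _ _ _ _ _).trans ?_)
  filter_upwards [h.ae₁ μ ν (L2.at_ae ψ (Classical.arbitrary M₁) μ),
    h.ae₂ μ ν (L2.at_ae φ (Classical.arbitrary M₂) ν)] with x h1 h2
  rw [h1, h2]

theorem tmul_mk (μ : M₁) (ν : M₂) {f : X₁ → 𝕜} {g : X₂ → 𝕜} (hf : MemLp f 2 (μ : Measure X₁))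
    (hg : MemLp g 2 (ν : Measure X₂)) :
    h.tmul (L2.mk μ f hf) (L2.mk ν g hg)
      = L2.mk (h.pr μ ν) (fun x => f (p₁ x) * g (p₂ x)) (h.memLp_mul μ ν hf hg) := by
  apply L2.ext_at (h.pr μ ν)
  refine (h.tmul_member _ _ μ ν).trans (.trans ?_ (L2.mk_at_self _ _ _).symm)
  filter_upwards [h.ae₁ μ ν (L2.mk_at_self μ f hf), h.ae₂ μ ν (L2.mk_at_self ν g hg)] with x h1 h2
  rw [h1, h2]

theorem tmul_add (ψ : L2 𝕜 M₁) (φ φ' : L2 𝕜 M₂) :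
    h.tmul ψ (φ + φ') = h.tmul ψ φ + h.tmul ψ φ' := by
  let μ := Classical.arbitrary M₁
  let ν := Classical.arbitrary M₂
  apply L2.ext_at (h.pr μ ν)
  rw [map_add]
  refine (h.tmul_member _ _ μ ν).trans (.trans ?_ (Lp.coeFn_add _ _).symm)
  have h0 := Lp.coeFn_add (L2.member ν φ) (L2.member ν φ')
  rw [← map_add] at h0
  filter_upwards [h.ae₂ μ ν h0, h.tmul_member ψ φ μ ν, h.tmul_member ψ φ' μ ν] with x h1 h2 h3
  rw [Pi.add_apply, h1, h2, h3, Pi.add_apply, mul_add]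

theorem add_tmul (ψ ψ' : L2 𝕜 M₁) (φ : L2 𝕜 M₂) :
    h.tmul (ψ + ψ') φ = h.tmul ψ φ + h.tmul ψ' φ := by
  let μ := Classical.arbitrary M₁
  let ν := Classical.arbitrary M₂
  apply L2.ext_at (h.pr μ ν)
  rw [map_add]
  refine (h.tmul_member _ _ μ ν).trans (.trans ?_ (Lp.coeFn_add _ _).symm)
  have h0 := Lp.coeFn_add (L2.member μ ψ) (L2.member μ ψ')
  rw [← map_add] at h0
  filter_upwards [h.ae₁ μ ν h0, h.tmul_member ψ φ μ ν, h.tmul_member ψ' φ μ ν] with x h1 h2 h3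
  rw [Pi.add_apply, h1, h2, h3, Pi.add_apply, add_mul]

theorem tmul_smul (c : 𝕜) (ψ : L2 𝕜 M₁) (φ : L2 𝕜 M₂) :
    h.tmul ψ (c • φ) = c • h.tmul ψ φ := by
  let μ := Classical.arbitrary M₁
  let ν := Classical.arbitrary M₂
  apply L2.ext_at (h.pr μ ν)
  rw [map_smul]
  refine (h.tmul_member _ _ μ ν).trans (.trans ?_ (Lp.coeFn_smul _ _).symm)
  have h0 := Lp.coeFn_smul c (L2.member ν φ)
  rw [← map_smul] at h0
  filter_upwards [h.ae₂ μ ν h0, h.tmul_member ψ φ μ ν] with x h1 h2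
  rw [Pi.smul_apply, h1, h2, Pi.smul_apply, mul_smul_comm]

theorem smul_tmul (c : 𝕜) (ψ : L2 𝕜 M₁) (φ : L2 𝕜 M₂) :
    h.tmul (c • ψ) φ = c • h.tmul ψ φ := by
  let μ := Classical.arbitrary M₁
  let ν := Classical.arbitrary M₂
  apply L2.ext_at (h.pr μ ν)
  rw [map_smul]
  refine (h.tmul_member _ _ μ ν).trans (.trans ?_ (Lp.coeFn_smul _ _).symm)
  have h0 := Lp.coeFn_smul c (L2.member μ ψ)
  rw [← map_smul] at h0
  filter_upwards [h.ae₁ μ ν h0, h.tmul_member ψ φ μ ν] with x h1 h2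
  rw [Pi.smul_apply, h1, h2, Pi.smul_apply, smul_mul_assoc]

/-- The canonical bilinear map `L₂(M₁) × L₂(M₂) → L₂(M)`, `(ψ, φ) ↦ ψ ⊗ φ`. -/
noncomputable def tensor : L2 𝕜 M₁ →ₗ[𝕜] L2 𝕜 M₂ →ₗ[𝕜] L2 𝕜 M :=
  LinearMap.mk₂ 𝕜 h.tmul h.add_tmul h.smul_tmul h.tmul_add h.tmul_smul

theorem inner_tensor (ψ ψ' : L2 𝕜 M₁) (φ φ' : L2 𝕜 M₂) :
    inner 𝕜 (h.tensor ψ φ) (h.tensor ψ' φ') = inner 𝕜 ψ ψ' * inner 𝕜 φ φ' := by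
  change inner 𝕜 (h.tmul ψ φ) (h.tmul ψ' φ') = _
  let μ := Classical.arbitrary M₁
  let ν := Classical.arbitrary M₂
  have hm : AEStronglyMeasurable (fun x => inner 𝕜 (L2.member (h.pr μ ν) (h.tmul ψ φ) x)
      (L2.member (h.pr μ ν) (h.tmul ψ' φ') x)) (h.pr μ ν : Measure X) :=
    (Lp.aestronglyMeasurable _).inner (Lp.aestronglyMeasurable _)
  rw [L2.inner_eq_integral _ _ (h.pr μ ν), L2.inner_eq_integral ψ ψ' μ,
    L2.inner_eq_integral φ φ' ν, ← integral_prod_mul]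
  refine (integral_map h.meas.aemeasurable hm).trans (integral_congr_ae ?_)
  filter_upwards [h.left_inv μ ν, ae_of_ae_map h.meas.aemeasurable (h.tmul_member ψ φ μ ν),
    ae_of_ae_map h.meas.aemeasurable (h.tmul_member ψ' φ' μ ν)] with z h1 h2 h3
  rw [h2, h3, h1.1, h1.2]
  simp only [RCLike.inner_apply, map_mul]
  ring

theorem ae_zero_of_rectangles {μ : Measure X₁} {ν : Measure X₂} [IsFiniteMeasure μ]
    [IsFiniteMeasure ν] {F : X₁ × X₂ → 𝕜} (hF : Integrable F (μ.prod ν))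
    (h0 : ∀ (s : Set X₁) (t : Set X₂), MeasurableSet s → MeasurableSet t →
      ∫ z in s ×ˢ t, F z ∂(μ.prod ν) = 0) : F =ᵐ[μ.prod ν] 0 := by
  have htot : ∫ z, F z ∂(μ.prod ν) = 0 := by
    have := h0 Set.univ Set.univ .univ .univ
    rwa [Set.univ_prod_univ, setIntegral_univ] at this
  refine ae_eq_zero_of_forall_setIntegral_eq_of_sigmaFinite (fun s _ _ => hF.integrableOn) ?_
  intro u hu _
  induction u, hu using MeasurableSpace.induction_on_inter generateFrom_prod.symm isPiSystem_prod with
  | empty => simp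
  | basic t ht =>
    obtain ⟨a, ha, b, hb, rfl⟩ := ht
    exact h0 a b ha hb
  | compl t ht ih =>
    rw [setIntegral_compl ht hF, htot, ih (measure_lt_top _ _), sub_zero]
  | iUnion f hd hf ih =>
    rw [integral_iUnion hf hd hF.integrableOn]
    simp [ih _ (measure_lt_top _ _)]

theorem span_tensor :
    (Submodule.span 𝕜 {x : L2 𝕜 M | ∃ ψ φ, x = h.tensor ψ φ}).topologicalClosure = ⊤ := by
  rw [Submodule.topologicalClosure_eq_top_iff, Submodule.eq_bot_iff]
  intro χ hχ
  rw [Submodule.mem_orthogonal] at hχ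
  let μ := Classical.arbitrary M₁
  let ν := Classical.arbitrary M₂
  set F := L2.member (h.pr μ ν) χ with hFdef
  have hF : MemLp (F ∘ j) 2 ((μ : Measure X₁).prod (ν : Measure X₂)) :=
    (memLp_map_measure_iff (Lp.aestronglyMeasurable _) h.meas.aemeasurable).1 (Lp.memLp _)
  have hint : Integrable (F ∘ j) ((μ : Measure X₁).prod (ν : Measure X₂)) :=
    hF.integrable (by norm_num)
  have hz : (F ∘ j) =ᵐ[(μ : Measure X₁).prod (ν : Measure X₂)] 0 := by
    refine ae_zero_of_rectangles hint fun s t hs ht => ?_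
    have hs' : MemLp (s.indicator fun _ => (1 : 𝕜)) 2 (μ : Measure X₁) :=
      memLp_indicator_const 2 hs 1 (Or.inr (measure_ne_top _ _))
    have ht' : MemLp (t.indicator fun _ => (1 : 𝕜)) 2 (ν : Measure X₂) :=
      memLp_indicator_const 2 ht 1 (Or.inr (measure_ne_top _ _))
    have horth := hχ (h.tensor (L2.mk μ _ hs') (L2.mk ν _ ht'))
      (Submodule.subset_span ⟨_, _, rfl⟩)
    change inner 𝕜 (h.tmul _ _) χ = 0 at horth
    rw [h.tmul_mk, L2.inner_eq_integral _ _ (h.pr μ ν)] at horth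
    have hm : AEStronglyMeasurable (fun x => inner 𝕜 (L2.member (h.pr μ ν) (L2.mk (h.pr μ ν)
      _ (h.memLp_mul μ ν hs' ht')) x) (L2.member (h.pr μ ν) χ x)) (h.pr μ ν : Measure X) :=
      (Lp.aestronglyMeasurable _).inner (Lp.aestronglyMeasurable _)
    rw [← integral_indicator (hs.prod ht), ← horth]
    refine Eq.trans (integral_congr_ae ?_) (integral_map h.meas.aemeasurable hm).symm
    filter_upwards [h.left_inv μ ν, ae_of_ae_map h.meas.aemeasurable
      (L2.mk_at_self (h.pr μ ν) _ (h.memLp_mul μ ν hs' ht'))] with z h1 h2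
    rw [h2, h1.1, h1.2, ← hFdef]
    by_cases hzs : z.1 ∈ s <;> by_cases hzt : z.2 ∈ t <;> simp [Set.indicator, hzs, hzt]
  apply L2.ext_at (h.pr μ ν)
  rw [map_zero]
  refine Filter.EventuallyEq.trans ?_ (Lp.coeFn_zero _ _ _).symm
  have hFm : StronglyMeasurable F := Lp.stronglyMeasurable _
  change ∀ᵐ x ∂(Measure.map j _), F x = 0
  exact (ae_map_iff h.meas.aemeasurable (hFm.measurable (measurableSet_singleton 0))).2 hz

end IsProduct

end Product

end MeasureClass

/-- A continuous product of Hilbert spaces over `[0,1]`: Hilbert spaces `H_{s,t} ≠ {0}`,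
`0 ≤ s < t ≤ 1`, and unitary operators `W_{r,s,t} : H_{r,s} ⊗ H_{s,t} → H_{r,t}` satisfying the
associativity condition. All Hilbert spaces are separable. A unitary operator from the Hilbert
space tensor product is given as the bilinear map `(x, y) ↦ W (x ⊗ y)`: that `W` is isometric is
`inner_W`, and that it is onto is `span_W`. -/
structure CPHS (𝕜 : Type*) [RCLike 𝕜] where
  H : ∀ s t : unitInterval, s < t → Type*
  [normed : ∀ s t h, NormedAddCommGroup (H s t h)]
  [innerProduct : ∀ s t h, InnerProductSpace 𝕜 (H s t h)]
  [complete : ∀ s t h, CompleteSpace (H s t h)]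
  [separable : ∀ s t h, SeparableSpace (H s t h)]
  [nontrivial : ∀ s t h, Nontrivial (H s t h)]
  W : ∀ {r s t : unitInterval} (hrs : r < s) (hst : s < t),
    H r s hrs →ₗ[𝕜] H s t hst →ₗ[𝕜] H r t (hrs.trans hst)
  inner_W : ∀ {r s t : unitInterval} (hrs : r < s) (hst : s < t) (x x' : H r s hrs)
    (y y' : H s t hst),
    inner 𝕜 (W hrs hst x y) (W hrs hst x' y') = inner 𝕜 x x' * inner 𝕜 y y'
  span_W : ∀ {r s t : unitInterval} (hrs : r < s) (hst : s < t),
    (Submodule.span 𝕜 {z | ∃ x y, z = W hrs hst x y}).topologicalClosure = ⊤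
  assoc : ∀ {r s t u : unitInterval} (hrs : r < s) (hst : s < t) (htu : t < u)
    (x : H r s hrs) (y : H s t hst) (z : H t u htu),
    W (hrs.trans hst) htu (W hrs hst x y) z = W hrs (hst.trans htu) x (W hst htu y z)

namespace CPHS

attribute [instance] normed innerProduct complete separable nontrivial

variable {𝕜 : Type*} [RCLike 𝕜] (𝓗 : CPHS 𝕜)

/-- The Hilbert space `H_{0,1}`. -/
abbrev total : Type _ := 𝓗.H 0 1 zero_lt_one

/-- A decomposable vector: `ψ ∈ H_{0,1}`, `ψ ≠ 0`, such that for every `t ∈ (0,1)`, `ψ` is of the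
form `ψ' ⊗ ψ''` for some `ψ' ∈ H_{0,t}`, `ψ'' ∈ H_{t,1}`. -/
def IsDecomposableVector (ψ : 𝓗.total) : Prop :=
  ψ ≠ 0 ∧ ∀ (t : unitInterval) (h0 : 0 < t) (h1 : t < 1),
    ∃ (ψ' : 𝓗.H 0 t h0) (ψ'' : 𝓗.H t 1 h1), ψ = 𝓗.W h0 h1 ψ' ψ''

/-- Type `I`: the decomposable vectors span `H_{0,1}` as a closed linear space. -/
def IsTypeI : Prop :=
  (Submodule.span 𝕜 {ψ | 𝓗.IsDecomposableVector ψ}).topologicalClosure = ⊤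

/-- Type `III`: there are no decomposable vectors. -/
def IsTypeIII : Prop := ∀ ψ, ¬ 𝓗.IsDecomposableVector ψ

/-- Type `II`: neither type `I` nor type `III`. -/
def IsTypeII : Prop := ¬ 𝓗.IsTypeI ∧ ¬ 𝓗.IsTypeIII

/-- Type `II₀`: type `II`, and all decomposable vectors belong to a single one-dimensional
subspace of `H_{0,1}`. -/
def IsTypeII0 : Prop :=
  𝓗.IsTypeII ∧ ∃ L : Submodule 𝕜 𝓗.total, Module.finrank 𝕜 L = 1 ∧
    ∀ ψ, 𝓗.IsDecomposableVector ψ → ψ ∈ L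

end CPHS

section ClosedSets

/-- The Effros σ-field on the set of all closed subsets of `ℝ`: it is generated by the sets
`{C | C ∩ U ≠ ∅}`, `U` open. -/
instance effros : MeasurableSpace (Closeds ℝ) :=
  .generateFrom {S | ∃ U : Set ℝ, IsOpen U ∧ S = {C : Closeds ℝ | ((C : Set ℝ) ∩ U).Nonempty}}

namespace MeasureClass

theorem measurableSet_hit_open {U : Set ℝ} (hU : IsOpen U) :
    MeasurableSet {C : Closeds ℝ | ((C : Set ℝ) ∩ U).Nonempty} :=
  .basic _ ⟨U, hU, rfl⟩

theorem measurableSet_hit_compact {K : Set ℝ} (hK : IsCompact K) :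
    MeasurableSet {C : Closeds ℝ | ((C : Set ℝ) ∩ K).Nonempty} := by
  have : {C : Closeds ℝ | ((C : Set ℝ) ∩ K).Nonempty} =
      ⋂ n : ℕ, {C : Closeds ℝ | ((C : Set ℝ) ∩ Metric.thickening (1 / (n + 1 : ℝ)) K).Nonempty} := by
    ext C
    simp only [Set.mem_ofPred_eq, Set.mem_iInter]
    constructor
    · exact fun h n => h.mono (Set.inter_subset_inter_right _
        (Metric.self_subset_thickening (by positivity) K))
    · intro h
      by_contra hne
      have hd : Disjoint K (C : Set ℝ) := by
        rw [Set.disjoint_iff_inter_eq_empty, Set.inter_comm]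
        exact Set.not_nonempty_iff_eq_empty.1 hne
      obtain ⟨δ, hδ, hdis⟩ := hd.exists_thickenings hK C.isClosed
      obtain ⟨n, hn⟩ := exists_nat_one_div_lt hδ
      obtain ⟨x, hxC, hx⟩ := h n
      exact Set.disjoint_left.1 hdis (Metric.thickening_mono hn.le K hx)
        (Metric.self_subset_thickening hδ _ hxC)
  rw [this]
  exact .iInter fun n => measurableSet_hit_open Metric.isOpen_thickening

theorem measurable_inf_const (K : Closeds ℝ) : Measurable fun C : Closeds ℝ => C ⊓ K := by
  refine measurable_generateFrom ?_
  rintro _ ⟨U, hU, rfl⟩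
  obtain ⟨F, hF, -, hFU, -⟩ := hU.exists_iUnion_isClosed
  have : (fun C : Closeds ℝ => C ⊓ K) ⁻¹' {C | ((C : Set ℝ) ∩ U).Nonempty} =
      ⋃ (n : ℕ) (m : ℕ), {C : Closeds ℝ |
        ((C : Set ℝ) ∩ (Metric.closedBall 0 m ∩ ((K : Set ℝ) ∩ F n))).Nonempty} := by
    ext C
    simp only [Set.mem_preimage, Set.mem_ofPred_eq, Set.mem_iUnion, Closeds.coe_inf, ← hFU]
    constructor
    · rintro ⟨x, ⟨hC, hK⟩, hx⟩
      obtain ⟨n, hn⟩ := Set.mem_iUnion.1 hx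
      obtain ⟨m, hm⟩ := exists_nat_ge (dist x 0)
      exact ⟨n, m, x, hC, hm, hK, hn⟩
    · rintro ⟨n, m, x, hC, hm, hK, hn⟩
      exact ⟨x, ⟨hC, hK⟩, Set.mem_iUnion.2 ⟨n, hn⟩⟩
  rw [this]
  exact .iUnion fun n => .iUnion fun m => measurableSet_hit_compact
    ((isCompact_closedBall 0 _).inter_right (K.isClosed.inter (hF n)))

theorem measurable_sup_closeds : Measurable fun z : Closeds ℝ × Closeds ℝ => z.1 ⊔ z.2 := by
  refine measurable_generateFrom ?_
  rintro _ ⟨U, hU, rfl⟩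
  have : (fun z : Closeds ℝ × Closeds ℝ => z.1 ⊔ z.2) ⁻¹' {C | ((C : Set ℝ) ∩ U).Nonempty} =
      Prod.fst ⁻¹' {C : Closeds ℝ | ((C : Set ℝ) ∩ U).Nonempty} ∪
      Prod.snd ⁻¹' {C : Closeds ℝ | ((C : Set ℝ) ∩ U).Nonempty} := by
    ext z
    simp [Set.union_inter_distrib_right, Set.union_nonempty]
  rw [this]
  exact (measurable_fst (measurableSet_hit_open hU)).union
    (measurable_snd (measurableSet_hit_open hU))

theorem measurableSet_contains (x : ℝ) : MeasurableSet {C : Closeds ℝ | x ∈ C} := by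
  have : {C : Closeds ℝ | x ∈ C} = {C : Closeds ℝ | ((C : Set ℝ) ∩ {x}).Nonempty} := by
    ext C; simp
  rw [this]
  exact measurableSet_hit_compact isCompact_singleton

theorem measurableSet_within (K : Closeds ℝ) : MeasurableSet {C : Closeds ℝ | C ≤ K} := by
  have : {C : Closeds ℝ | C ≤ K} = {C : Closeds ℝ | ((C : Set ℝ) ∩ (K : Set ℝ)ᶜ).Nonempty}ᶜ := by
    ext C
    simp only [Set.mem_ofPred_eq, Set.mem_compl_iff, Set.not_nonempty_iff_eq_empty,
      ← Set.sdiff_eq, Set.sdiff_eq_empty]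
    rfl
  rw [this]
  exact (measurableSet_hit_open K.isClosed.isOpen_compl).compl

instance : MeasurableSpace.CountablyGenerated (Closeds ℝ) := by
  refine ⟨(fun U : Set ℝ => {C : Closeds ℝ | ((C : Set ℝ) ∩ U).Nonempty}) '' countableBasis ℝ,
    (countable_countableBasis ℝ).image _, le_antisymm ?_ ?_⟩
  · refine MeasurableSpace.generateFrom_le ?_
    rintro _ ⟨U, hU, rfl⟩
    obtain ⟨S, hS, rfl⟩ := (isBasis_countableBasis ℝ).open_eq_sUnion hU
    have : {C : Closeds ℝ | ((C : Set ℝ) ∩ ⋃₀ S).Nonempty} =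
        ⋃ U ∈ S, {C : Closeds ℝ | ((C : Set ℝ) ∩ U).Nonempty} := by
      ext C
      simp [Set.inter_nonempty, Set.mem_sUnion]
      tauto
    rw [this]
    exact .biUnion ((countable_countableBasis ℝ).mono hS) fun U hU => .basic _ ⟨U, hS hU, rfl⟩
  · refine MeasurableSpace.generateFrom_mono ?_
    rintro _ ⟨U, hU, rfl⟩
    exact ⟨U, isOpen_of_mem_countableBasis hU, rfl⟩

theorem sup_measure_assoc (μ ν κ : Measure (Closeds ℝ)) [SFinite μ] [SFinite ν] [SFinite κ] :
    ((((μ.prod ν).map fun z => z.1 ⊔ z.2).prod κ).map fun z => z.1 ⊔ z.2) =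
      (μ.prod ((ν.prod κ).map fun z => z.1 ⊔ z.2)).map fun z => z.1 ⊔ z.2 := by
  have h1 := Measure.map_prod_map (μ.prod ν) κ measurable_sup_closeds measurable_id
  have h2 := Measure.map_prod_map μ (ν.prod κ) measurable_id measurable_sup_closeds
  rw [Measure.map_id] at h1 h2
  rw [h1, h2, ← Measure.prodAssoc_prod, Measure.map_map measurable_sup_closeds
      (measurable_sup_closeds.prodMap measurable_id),
    Measure.map_map measurable_sup_closeds (measurable_id.prodMap measurable_sup_closeds),
    Measure.map_map (measurable_sup_closeds.comp (measurable_id.prodMap measurable_sup_closeds))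
      MeasurableEquiv.prodAssoc.measurable]
  congr 1
  funext z
  exact sup_assoc _ _ _

/-- The closed interval `[s,t]`. -/
def seg (s t : ℝ) : Closeds ℝ := ⟨Set.Icc s t, isClosed_Icc⟩

/-- The half-line `(-∞,s]`. -/
def leftRay (s : ℝ) : Closeds ℝ := ⟨Set.Iic s, isClosed_Iic⟩

/-- The half-line `[s,∞)`. -/
def rightRay (s : ℝ) : Closeds ℝ := ⟨Set.Ici s, isClosed_Ici⟩

/-- The sub-σ-field generated by the map `C ↦ C ∩ K`. -/
@[reducible] def fieldOn (K : Closeds ℝ) : MeasurableSpace (Closeds ℝ) := effros.comap fun C => C ⊓ K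

/-- A decomposable equivalence class of measures on the space of closed subsets of `ℝ`:
(a) for each `s ∈ ℝ`, the sub-σ-fields generated by `C ↦ C ∩ (-∞,s]` and `C ↦ C ∩ [s,∞)` are
independent on the measure class; (b) for each `t ∈ ℝ`, the set `{C | t ∈ C}` is negligible. -/
structure IsDecomposable (M : MeasureClass (Closeds ℝ)) : Prop where
  indep : ∀ s : ℝ, Indep (fieldOn (leftRay s)) (fieldOn (rightRay s)) M
  notMem : ∀ t : ℝ, M.AE fun C => t ∉ C

/-- The measure class `M_{s,t}`, consisting of the images of the measures `μ ∈ M` under the map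
`C ↦ C ∩ [s,t]`. It is concentrated on the closed subsets of `[s,t]`. -/
noncomputable def onSegment (M : MeasureClass (Closeds ℝ)) (s t : ℝ) : MeasureClass (Closeds ℝ) :=
  M.map (fun C => C ⊓ seg s t) (measurable_inf_const _)

variable {M : MeasureClass (Closeds ℝ)}

theorem IsDecomposable.exists_prod (hM : M.IsDecomposable) (r s t : ℝ) : ∃ μ ∈ M.carrier, IsProbabilityMeasure μ ∧
      (μ.map fun C => (C ⊓ seg r s, C ⊓ seg s t)) =
        (μ.map fun C => C ⊓ seg r s).prod (μ.map fun C => C ⊓ seg s t) := by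
  obtain ⟨μ, hμ, hp, hi⟩ := hM.indep s
  refine ⟨μ, hμ, hp, ?_⟩
  have h1 : ProbabilityTheory.IndepFun (fun C : Closeds ℝ => C ⊓ leftRay s)
      (fun C => C ⊓ rightRay s) μ := (ProbabilityTheory.IndepFun_iff_Indep _ _ _).2 hi
  have h2 := h1.comp (measurable_inf_const (seg r s)) (measurable_inf_const (seg s t))
  have e1 : ((fun C : Closeds ℝ => C ⊓ seg r s) ∘ fun C => C ⊓ leftRay s) =
      fun C => C ⊓ seg r s := by
    funext C
    simp only [Function.comp, inf_assoc]
    congr 1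
    exact inf_eq_right.2 (fun x hx => hx.2)
  have e2 : ((fun C : Closeds ℝ => C ⊓ seg s t) ∘ fun C => C ⊓ rightRay s) =
      fun C => C ⊓ seg s t := by
    funext C
    simp only [Function.comp, inf_assoc]
    congr 1
    exact inf_eq_right.2 (fun x hx => hx.1)
  rw [e1, e2] at h2
  exact (ProbabilityTheory.indepFun_iff_map_prod_eq_prod_map_map
    (measurable_inf_const _).aemeasurable (measurable_inf_const _).aemeasurable).1 h2

theorem onSegment_le (M : MeasureClass (Closeds ℝ)) (s t : ℝ) :
    (M.onSegment s t).AE fun C => C ≤ seg s t := by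
  rintro _ ⟨μ, hμ, rfl⟩
  rw [ae_map_iff (measurable_inf_const _).aemeasurable (measurableSet_within _)]
  exact .of_forall fun C => inf_le_right

theorem IsDecomposable.onSegment_notMem (hM : M.IsDecomposable) (s t x : ℝ) :
    (M.onSegment s t).AE fun C => x ∉ C := by
  rintro _ ⟨μ, hμ, rfl⟩
  refine (ae_map_iff (measurable_inf_const _).aemeasurable (measurableSet_contains x).compl).2 ?_
  filter_upwards [hM.notMem x μ hμ] with C hC h
  exact hC h.1

theorem segment_split {r s t : ℝ} (hrs : r < s) (hst : s < t) :
    seg r s ⊔ seg s t = seg r t :=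
  SetLike.coe_injective (Set.Icc_union_Icc_eq_Icc hrs.le hst.le)

theorem seg_inf_seg (C : Closeds ℝ) {a b a' b' : ℝ} (ha : a ≤ a') (hb : b' ≤ b) :
    C ⊓ seg a b ⊓ seg a' b' = C ⊓ seg a' b' := by
  have : seg a' b' ≤ seg a b := fun x hx => ⟨ha.trans hx.1, hx.2.trans hb⟩
  rw [inf_assoc, inf_eq_right.2 this]

/-- `M_{r,t} = M_{r,s} × M_{s,t}`. -/
theorem IsDecomposable.isProduct (hM : M.IsDecomposable) {r s t : ℝ} (hrs : r < s) (hst : s < t) :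
    IsProduct (M.onSegment r s) (M.onSegment s t) (M.onSegment r t)
      (fun C => C ⊓ seg r s) (fun C => C ⊓ seg s t) (fun z => z.1 ⊔ z.2) where
  meas₁ := measurable_inf_const _
  meas₂ := measurable_inf_const _
  meas := measurable_sup_closeds
  map_mem μ ν := by
    obtain ⟨μ₀, h₀, hp, hprod⟩ := hM.exists_prod r s t
    have hm1 : Measurable fun C : Closeds ℝ => (C ⊓ seg r s, C ⊓ seg s t) :=
      (measurable_inf_const _).prodMk (measurable_inf_const _)
    have e : (((μ₀.map fun C => C ⊓ seg r s).prod (μ₀.map fun C => C ⊓ seg s t)).map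
        fun z => z.1 ⊔ z.2) = μ₀.map fun C => C ⊓ seg r t := by
      rw [← hprod, Measure.map_map measurable_sup_closeds hm1]
      congr 1
      funext C
      simp only [Function.comp, ← inf_sup_left, segment_split hrs hst]
    let μ₁ : M.onSegment r s := ⟨_, map_mem _ (measurable_inf_const _) h₀⟩
    let ν₁ : M.onSegment s t := ⟨_, map_mem _ (measurable_inf_const _) h₀⟩
    refine ((M.onSegment r t).mem_iff _ (map_mem _ (measurable_inf_const _) h₀) _
      inferInstance).2 ?_
    rw [← e]
    exact ⟨((ac μ μ₁).prod (ac ν ν₁)).map measurable_sup_closeds,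
      ((ac μ₁ μ).prod (ac ν₁ ν)).map measurable_sup_closeds⟩
  left_inv μ ν := by
    have a1 := Measure.quasiMeasurePreserving_fst (μ := (μ : Measure (Closeds ℝ)))
      (ν := (ν : Measure (Closeds ℝ)))
    have a2 := Measure.quasiMeasurePreserving_snd (μ := (μ : Measure (Closeds ℝ)))
      (ν := (ν : Measure (Closeds ℝ)))
    filter_upwards [a1.ae (onSegment_le M r s _ μ.2), a1.ae (hM.onSegment_notMem r s s _ μ.2),
      a2.ae (onSegment_le M s t _ ν.2), a2.ae (hM.onSegment_notMem s t s _ ν.2)]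
      with z h1 h2 h3 h4
    constructor
    · apply SetLike.coe_injective
      ext x
      simp only [Closeds.coe_inf, Closeds.coe_sup, Set.mem_inter_iff, Set.mem_union]
      constructor
      · rintro ⟨hx | hx, hx'⟩
        · exact hx
        · exact absurd hx (by rwa [le_antisymm hx'.2 (h3 hx).1])
      · exact fun hx => ⟨.inl hx, h1 hx⟩
    · apply SetLike.coe_injective
      ext x
      simp only [Closeds.coe_inf, Closeds.coe_sup, Set.mem_inter_iff, Set.mem_union]
      constructor
      · rintro ⟨hx | hx, hx'⟩
        · exact absurd hx (by rwa [le_antisymm (h1 hx).2 hx'.1])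
        · exact hx
      · exact fun hx => ⟨.inr hx, h3 hx⟩
  right_inv := by
    intro μ hμ
    filter_upwards [onSegment_le M r t μ hμ] with C hC
    rw [← inf_sup_left, segment_split hrs hst]
    exact inf_eq_left.2 hC

variable (𝕜 : Type*) [RCLike 𝕜]

/-- The continuous product of Hilbert spaces over `[0,1]` corresponding to a decomposable
equivalence class `M` of measures: `H_{s,t} = L₂(M_{s,t})`, with the operators `W_{r,s,t}` given by
`M_{r,s} × M_{s,t} = M_{r,t}`. -/
noncomputable def IsDecomposable.cphs (hM : M.IsDecomposable) : CPHS 𝕜 where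
  H s t _ := L2 𝕜 (M.onSegment s t)
  nontrivial s t _ := by
    obtain ⟨μ, hμ, hp, -⟩ := hM.indep 0
    refine L2.nontrivial ⟨_, map_mem _ (measurable_inf_const _) hμ⟩ ?_
    have := Measure.isProbabilityMeasure_map (μ := μ)
      (measurable_inf_const (seg s t)).aemeasurable
    exact IsProbabilityMeasure.ne_zero (μ.map fun C => C ⊓ seg s t)
  W hrs hst := (hM.isProduct hrs hst).tensor
  inner_W hrs hst := (hM.isProduct hrs hst).inner_tensor
  span_W hrs hst := (hM.isProduct hrs hst).span_tensor
  assoc {r s t u} hrs hst htu x y z := by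
    have hrs' : (r : ℝ) < s := hrs
    have hst' : (s : ℝ) < t := hst
    have htu' : (t : ℝ) < u := htu
    let P₁ := hM.isProduct hrs' hst'
    let P₂ := hM.isProduct (hrs'.trans hst') htu'
    let P₃ := hM.isProduct hst' htu'
    let P₄ := hM.isProduct hrs' (hst'.trans htu')
    change P₂.tmul (P₁.tmul x y) z = P₄.tmul x (P₃.tmul y z)
    let μ := Classical.arbitrary (M.onSegment r s)
    let ν := Classical.arbitrary (M.onSegment s t)
    let κ := Classical.arbitrary (M.onSegment t u)
    have e : (P₂.pr (P₁.pr μ ν) κ : M.onSegment r u) = P₄.pr μ (P₃.pr ν κ) := by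
      apply Subtype.ext
      exact sup_measure_assoc _ _ _
    apply L2.ext_at (P₂.pr (P₁.pr μ ν) κ)
    have h1 := P₂.tmul_member (P₁.tmul x y) z (P₁.pr μ ν) κ
    have h2 := P₂.ae₁ (P₁.pr μ ν) κ (P₁.tmul_member x y μ ν)
    have h3 := P₄.tmul_member x (P₃.tmul y z) μ (P₃.pr ν κ)
    have h4 := P₄.ae₂ μ (P₃.pr ν κ) (P₃.tmul_member y z ν κ)
    rw [← e] at h3 h4
    filter_upwards [h1, h2, h3, h4] with C h1 h2 h3 h4
    have i1 : C ⊓ seg r t ⊓ seg r s = C ⊓ seg r s :=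
      seg_inf_seg C le_rfl hst'.le
    have i2 : C ⊓ seg r t ⊓ seg s t = C ⊓ seg s t :=
      seg_inf_seg C hrs'.le le_rfl
    have i3 : C ⊓ seg s u ⊓ seg s t = C ⊓ seg s t :=
      seg_inf_seg C le_rfl htu'.le
    have i4 : C ⊓ seg s u ⊓ seg t u = C ⊓ seg t u :=
      seg_inf_seg C hst'.le le_rfl
    rw [h1, h2, h3, h4, i1, i2, i3, i4, mul_assoc]

end MeasureClass

end ClosedSets

/-! A half-density `ψ = f√μ` has a spectral measure `|f|²μ`, which is finite, does not depend on the
choice of `μ`, and is absolutely continuous with respect to the class. The spectral measure of `ψ' ⊗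
ψ''` is the image of the product of the two spectral measures, so if `ψ` splits at `s`, then the
parts of `C` on the two sides of `s` are independent under its spectral measure. A decomposable
vector therefore provides one measure that makes the two sides independent for all `s` at once,
whereas in the class the measure may change with `s`.

This is very restrictive (`ae_finite_of_independent_pieces`). The mass of the sets avoiding an
interval is multiplicative under concatenation, up to the total mass, and it is positive on small
intervals because no fixed point belongs to `C`. By compactness it is positive on `[0,1]`, and then
the expected number of grid cells hit by `C` is bounded uniformly in the mesh. Fatou's lemma gives
that `C ∩ [0,1]` is almost surely finite. A perfect set without the points 0 and 1 cannot meet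
`[0,1]` in a nonempty finite set, so the spectral measure sits on the empty set (`spectral_eq_bot`).
Half-densities concentrated at the single point `∅` form at most a line, spanned by `vacuum`
(`exists_eq_smul_vacuum`).

Conversely, the empty set has positive mass on every segment (`measure_miss_ne_zero`) and a union is
empty exactly when both parts are, so the vacuum is nonzero and splits everywhere
(`exists_tmul_eq_vacuum`); type III is excluded. Type I would make the whole space one-dimensional,
which happens only if `C ∩ [0,1]` is empty almost everywhere. -/

namespace ClosedSets

open MeasureClass Filter

/-! ### Avoidance events and passage from small intervals to compact ones -/

/-- The closed sets that do not meet `[a,b]`. -/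
def miss (a b : ℝ) : Set (Closeds ℝ) := {C | C ⊓ seg a b = ⊥}

theorem mem_miss {C : Closeds ℝ} {a b : ℝ} : C ∈ miss a b ↔ ∀ x ∈ C, x ∉ Set.Icc a b := by
  constructor
  · intro h x hx hx'
    have : x ∈ (C ⊓ seg a b : Closeds ℝ) := ⟨hx, hx'⟩
    rw [show C ⊓ seg a b = ⊥ from h] at this
    exact this
  · intro h
    exact eq_bot_iff.2 fun x hx => (h x hx.1 hx.2).elim

theorem measurableSet_singleton_bot : MeasurableSet ({⊥} : Set (Closeds ℝ)) := by
  simpa [Set.ext_iff] using measurableSet_within (⊥ : Closeds ℝ)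

theorem measurableSet_miss (a b : ℝ) : MeasurableSet (miss a b) :=
  measurable_inf_const (seg a b) measurableSet_singleton_bot

theorem miss_mono {a b a' b' : ℝ} (ha : a ≤ a') (hb : b' ≤ b) : miss a b ⊆ miss a' b' :=
  fun _ hC => mem_miss.2 fun x hx hx' => mem_miss.1 hC x hx ⟨ha.trans hx'.1, hx'.2.trans hb⟩

theorem miss_inter_miss {a b c : ℝ} (hab : a ≤ b) (hbc : b ≤ c) :
    miss a b ∩ miss b c = miss a c := by
  apply subset_antisymm
  · rintro C ⟨h1, h2⟩
    refine mem_miss.2 fun x hx hx' => ?_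
    rcases le_total x b with h | h
    · exact mem_miss.1 h1 x hx ⟨hx'.1, h⟩
    · exact mem_miss.1 h2 x hx ⟨h, hx'.2⟩
  · exact Set.subset_inter (miss_mono le_rfl hbc) (miss_mono hab le_rfl)

theorem miss_inf_seg (a b c d : ℝ) (ha : c ≤ a) (hb : b ≤ d) :
    (fun C : Closeds ℝ => C ⊓ seg c d) ⁻¹' miss a b = miss a b := by
  ext C
  simp only [Set.mem_preimage, miss, Set.mem_ofPred_eq, seg_inf_seg C ha hb]

/-- A property of intervals that is stable under concatenation and holds for all small
intervals holds for all compact intervals. -/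
theorem interval_property_of_local {P : ℝ → ℝ → Prop} {a b : ℝ} (hab : a ≤ b)
    (hmono : ∀ s t s' t', s ≤ s' → t' ≤ t → P s t → P s' t')
    (hcat : ∀ s t, a ≤ s → s ≤ t → t ≤ b → P a s → P s t → P a t)
    (hloc : ∀ t, ∃ ε > 0, P (t - ε) (t + ε)) : P a b := by
  choose ε hε hP using hloc
  -- By compactness there is a finite subdivision of `[a,b]` each cell of which lies in one of the
  -- good neighbourhoods; the cells are then concatenated from the left.
  obtain ⟨t, h0, hmt, ⟨m, hm⟩, ht⟩ := exists_monotone_Icc_subset_open_cover_Icc hab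
    (c := fun x : ℝ => Subtype.val ⁻¹' Set.Ioo (x - ε x) (x + ε x))
    (fun x => isOpen_Ioo.preimage continuous_subtype_val)
    (fun x _ => Set.mem_iUnion.2 ⟨x, by constructor <;> linarith [hε x]⟩)
  have key : ∀ n, P a (t n) := by
    intro n
    induction n with
    | zero =>
      rw [h0]
      exact hmono _ _ _ _ (by linarith [hε a]) (by linarith [hε a]) (hP a)
    | succ n ih =>
      have hle : t n ≤ t (n + 1) := hmt n.le_succ
      obtain ⟨x, hx⟩ := ht n
      have h1 := hx (Set.left_mem_Icc.2 hle)
      have h2 := hx (Set.right_mem_Icc.2 hle)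
      exact hcat _ _ (t n).2.1 hle (t (n + 1)).2.2 ih (hmono _ _ _ _ h1.1.le h2.2.le (hP x))
  simpa [hm m le_rfl] using key m

/-- If almost every `C` met every interval `[t - 1/(n+1), t + 1/(n+1)]`, then `t` would be a limit
of points of `C`, hence a point of the closed set `C`. -/
theorem exists_measure_miss_ne_zero {μ : Measure (Closeds ℝ)} (hμ : μ ≠ 0) {t : ℝ}
    (ht : ∀ᵐ C ∂μ, t ∉ C) : ∃ ε > 0, μ (miss (t - ε) (t + ε)) ≠ 0 := by
  by_contra! h
  apply hμ
  have h1 : ∀ n : ℕ, ∀ᵐ C ∂μ, C ∉ miss (t - 1 / (n + 1)) (t + 1 / (n + 1)) := fun n =>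
    measure_eq_zero_iff_ae_notMem.1 (h _ (by positivity))
  rw [← ae_eq_bot, ← Filter.eventually_false_iff_eq_bot]
  filter_upwards [ht, ae_all_iff.2 h1] with C hC h2
  apply hC
  refine C.isClosed.closure_subset (Metric.mem_closure_iff.2 fun δ hδ => ?_)
  obtain ⟨n, hn⟩ := exists_nat_one_div_lt hδ
  have h3 := h2 n
  rw [mem_miss] at h3
  push Not at h3
  obtain ⟨x, hx, hx'⟩ := h3
  refine ⟨x, hx, ?_⟩
  rw [Real.dist_eq, abs_lt]
  constructor <;> linarith [hx'.1, hx'.2]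

/-! ### Counting points by grid cells -/

/-- The points `min (k/(n+1)) 1` that divide `[0,1]` into intervals of length at most
`1/(n+1)`. -/
noncomputable def grid (n k : ℕ) : ℝ := min (k / (n + 1 : ℝ)) 1

theorem grid_le_one (n k : ℕ) : grid n k ≤ 1 := min_le_right _ _

theorem grid_nonneg (n k : ℕ) : 0 ≤ grid n k := le_min (by positivity) zero_le_one

theorem grid_le_succ (n k : ℕ) : grid n k ≤ grid n (k + 1) := by
  refine min_le_min_right _ ?_
  push_cast
  gcongr
  linarith

/-- For `x = 1` the index is `n + 1`, and the cell is the degenerate interval `[1,1]` produced by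
the truncation at 1. This is why `hitCount` has `n + 2` summands. -/
theorem mem_grid_floor {x : ℝ} (h0 : 0 ≤ x) (h1 : x ≤ 1) (n : ℕ) :
    x ∈ Set.Icc (grid n ⌊x * (n + 1)⌋₊) (grid n (⌊x * (n + 1)⌋₊ + 1)) := by
  have hn : (0 : ℝ) < n + 1 := by positivity
  constructor
  · refine (min_le_left _ _).trans ?_
    rw [div_le_iff₀ hn]
    exact Nat.floor_le (by positivity)
  · refine le_min ?_ h1
    rw [le_div_iff₀ hn]
    push_cast
    exact (Nat.lt_floor_add_one _).le

/-- The number of intervals of the `n`-th grid hit by a closed set. -/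
noncomputable def hitCount (n : ℕ) (C : Closeds ℝ) : ℝ≥0∞ :=
  ∑ k ∈ Finset.range (n + 2), (miss (grid n k) (grid n (k + 1)))ᶜ.indicator (fun _ => 1) C

theorem measurable_hitCount (n : ℕ) : Measurable (hitCount n) :=
  Finset.measurable_sum _ fun _ _ => measurable_const.indicator (measurableSet_miss _ _).compl

/-- Once the mesh is smaller than all gaps in `F`, distinct points have distinct floors, so the
floor map injects `F` into the set of cells that are hit. -/
theorem eventually_card_le_hitCount {C : Closeds ℝ} (F : Finset ℝ)
    (hF : ∀ x ∈ F, x ∈ C ∧ x ∈ Set.Icc (0 : ℝ) 1) :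
    ∀ᶠ n in atTop, (F.card : ℝ≥0∞) ≤ hitCount n C := by
  classical
  have hsep : ∀ᶠ n : ℕ in atTop, ∀ x ∈ F, ∀ y ∈ F, x ≠ y →
      ⌊x * ((n : ℝ) + 1)⌋₊ ≠ ⌊y * ((n : ℝ) + 1)⌋₊ := by
    refine (Filter.eventually_all_finset F).2 fun x hx =>
      (Filter.eventually_all_finset F).2 fun y hy => ?_
    by_cases hxy : x = y
    · simp [hxy]
    have hpos : 0 < |x - y| := abs_pos.2 (sub_ne_zero.2 hxy)
    -- Equal floors would force `|x - y| (n + 1) < 1`, which is impossible for `n > 1/|x - y|`.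
    have hlim := (tendsto_natCast_atTop_atTop (R := ℝ)).eventually_gt_atTop (1 / |x - y|)
    filter_upwards [hlim] with n hn _ heq
    have hn0 : (0 : ℝ) ≤ n := n.cast_nonneg
    rw [div_lt_iff₀ hpos] at hn
    have a1 := Nat.floor_le (a := x * ((n : ℝ) + 1)) (mul_nonneg (hF x hx).2.1 (by positivity))
    have a2 := Nat.floor_le (a := y * ((n : ℝ) + 1)) (mul_nonneg (hF y hy).2.1 (by positivity))
    have a3 := Nat.lt_floor_add_one (x * ((n : ℝ) + 1))
    have a4 := Nat.lt_floor_add_one (y * ((n : ℝ) + 1))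
    rw [heq] at a1 a3
    have : |(x - y) * ((n : ℝ) + 1)| < 1 := by
      rw [abs_lt]
      constructor <;> linarith
    rw [abs_mul, abs_of_pos (by positivity : (0 : ℝ) < n + 1)] at this
    linarith
  filter_upwards [hsep] with n hn
  have hcount : hitCount n C = (((Finset.range (n + 2)).filter
      fun k => C ∉ miss (grid n k) (grid n (k + 1))).card : ℝ≥0∞) := by
    rw [hitCount, Finset.card_filter, Nat.cast_sum]
    refine Finset.sum_congr rfl fun k _ => ?_
    by_cases h : C ∈ miss (grid n k) (grid n (k + 1)) <;> simp [h]
  rw [hcount, Nat.cast_le]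
  refine Finset.card_le_card_of_injOn (fun x => ⌊x * ((n : ℝ) + 1)⌋₊) ?_ ?_
  · intro x hx
    obtain ⟨hC, h0, h1⟩ := hF x hx
    refine Finset.mem_coe.2 (Finset.mem_filter.2 ⟨Finset.mem_range.2 ?_, fun h =>
      mem_miss.1 h x hC (mem_grid_floor h0 h1 n)⟩)
    rw [Nat.floor_lt (by positivity)]
    push_cast
    nlinarith
  · intro x hx y hy hxy
    by_contra hne
    exact hn x hx y hy hne hxy

/-- An infinite intersection contains finite subsets of every size, and each of them bounds the
counts from below eventually. The lower limit is used because it is what Fatou's lemma controls;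
successive grids need not refine each other. -/
theorem finite_of_liminf_hitCount {C : Closeds ℝ}
    (h : liminf (fun n => hitCount n C) atTop ≠ ∞) : ((C : Set ℝ) ∩ Set.Icc 0 1).Finite := by
  by_contra hinf
  apply h
  refine ENNReal.eq_top_of_forall_nnreal_le fun r => ?_
  obtain ⟨m, hm⟩ := exists_nat_ge r
  obtain ⟨F, hF, hcard⟩ := Set.Infinite.exists_subset_card_eq hinf m
  refine le_trans ?_ (Filter.le_liminf_of_le (by isBoundedDefault)
    (eventually_card_le_hitCount F fun x hx => hF hx))
  rw [hcard]
  exact_mod_cast hm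

/-- A random closed set with independent pieces and without fixed points is finite. -/
theorem ae_finite_of_independent_pieces (ν : Measure (Closeds ℝ)) [IsFiniteMeasure ν]
    (hnot : ∀ t : ℝ, ∀ᵐ C ∂ν, t ∉ C)
    (hind : ∀ s t : ℝ, 0 < s → s < 1 → s ≤ t → t ≤ 1 →
      ν Set.univ * ν (miss 0 t) = ν (miss 0 s) * ν (miss s t)) :
    ∀ᵐ C : Closeds ℝ ∂ν, ((C : Set ℝ) ∩ Set.Icc 0 1).Finite := by
  by_cases hν : ν = 0
  · simp [hν]
  have hpt : ∀ t, ν (miss t t) = ν Set.univ := fun t => by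
    refine measure_congr (eventuallyEq_univ.2 ?_)
    filter_upwards [hnot t] with C hC
    refine mem_miss.2 fun x hx hx' => hC ?_
    rwa [← le_antisymm hx'.2 hx'.1]
  -- The factorization extends to `s = 0` and `s = 1`, since a degenerate interval is avoided almost
  -- surely.
  have hind' : ∀ s t : ℝ, 0 ≤ s → s ≤ t → t ≤ 1 →
      ν Set.univ * ν (miss 0 t) = ν (miss 0 s) * ν (miss s t) := by
    intro s t hs hst ht
    rcases hs.eq_or_lt with rfl | hs
    · rw [hpt]
    rcases (hst.trans ht).eq_or_lt with rfl | hs1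
    · rw [le_antisymm ht hst, hpt, mul_comm]
    exact hind s t hs hs1 hst ht
  have hpos : ν (miss 0 1) ≠ 0 := by
    refine interval_property_of_local (P := fun s t => ν (miss s t) ≠ 0) zero_le_one ?_ ?_
      fun t => exists_measure_miss_ne_zero hν (hnot t)
    · exact fun s t s' t' h1 h2 h h0 => h (measure_mono_null (miss_mono h1 h2) h0)
    · intro s t h1 h2 h3 h4 h5 h0
      have := hind' s t h1 h2 h3
      rw [h0, mul_zero] at this
      exact (mul_ne_zero h4 h5) this.symm
  -- Write `q(t)` for the mass of the sets avoiding `[0,t]`. Factorization gives that the mass of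
  -- hitting `[s,t]`, times `q(s)`, equals the total mass times `q(s) - q(t)`. Replacing `q(s)` by
  -- the smaller number `q(1)` leaves a bound that telescopes over the grid.
  have hreal : ∀ s t : ℝ, 0 ≤ s → s ≤ t → t ≤ 1 →
      ν.real (miss s t)ᶜ * ν.real (miss 0 1)
        ≤ ν.real Set.univ * (ν.real (miss 0 s) - ν.real (miss 0 t)) := by
    intro s t h1 h2 h3
    have e := congrArg ENNReal.toReal (hind' s t h1 h2 h3)
    rw [ENNReal.toReal_mul, ENNReal.toReal_mul] at e
    change ν.real _ * ν.real _ = ν.real _ * ν.real _ at e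
    have hc := measureReal_compl (μ := ν) (measurableSet_miss s t)
    have hm : ν.real (miss 0 1) ≤ ν.real (miss 0 s) :=
      measureReal_mono (miss_mono le_rfl (h2.trans h3))
    calc ν.real (miss s t)ᶜ * ν.real (miss 0 1)
        ≤ ν.real (miss s t)ᶜ * ν.real (miss 0 s) := by gcongr
      _ = _ := by rw [hc, mul_sub, e]; ring
  have hposr : 0 < ν.real (miss 0 1) := ENNReal.toReal_pos hpos (measure_ne_top _ _)
  -- The telescoping sum is at most the total mass, which appears once more as a factor; division by
  -- `q(1) > 0` gives a bound independent of `n`.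
  set K := ν.real Set.univ * ν.real Set.univ / ν.real (miss 0 1) with hK
  have hbound : ∀ n, ∫⁻ C, hitCount n C ∂ν ≤ ENNReal.ofReal K := by
    intro n
    have e : ∫⁻ C, hitCount n C ∂ν = ENNReal.ofReal
        (∑ k ∈ Finset.range (n + 2), ν.real (miss (grid n k) (grid n (k + 1)))ᶜ) := by
      simp only [hitCount]
      rw [lintegral_finsetSum _ fun _ _ =>
          measurable_const.indicator (measurableSet_miss _ _).compl,
        ENNReal.ofReal_sum_of_nonneg fun _ _ => measureReal_nonneg]
      refine Finset.sum_congr rfl fun k _ => ?_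
      rw [lintegral_indicator_const (measurableSet_miss _ _).compl, one_mul,
        ofReal_measureReal]
    rw [e]
    refine ENNReal.ofReal_le_ofReal ?_
    rw [hK, le_div_iff₀ hposr, Finset.sum_mul]
    calc _ ≤ ∑ k ∈ Finset.range (n + 2), ν.real Set.univ *
          (ν.real (miss 0 (grid n k)) - ν.real (miss 0 (grid n (k + 1)))) :=
          Finset.sum_le_sum fun k _ =>
            hreal _ _ (grid_nonneg n k) (grid_le_succ n k) (grid_le_one n _)
      _ = ν.real Set.univ * (ν.real (miss 0 (grid n 0)) - ν.real (miss 0 (grid n (n + 2)))) := by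
          rw [← Finset.mul_sum, Finset.sum_range_sub' fun k => ν.real (miss 0 (grid n k))]
      _ ≤ _ := by
          have h1 : ν.real (miss 0 (grid n 0)) ≤ ν.real Set.univ :=
            measureReal_mono (Set.subset_univ _)
          have h2 : 0 ≤ ν.real (miss 0 (grid n (n + 2))) := measureReal_nonneg
          gcongr
          linarith
  have hfatou : ∫⁻ C, liminf (fun n => hitCount n C) atTop ∂ν ≤ ENNReal.ofReal K := by
    refine (lintegral_liminf_le measurable_hitCount).trans ?_
    exact liminf_le_of_le (by isBoundedDefault) fun b hb =>
      let ⟨n, hn⟩ := hb.exists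
      hn.trans (hbound n)
  filter_upwards [ae_lt_top (Measurable.liminf measurable_hitCount)
    (hfatou.trans_lt ENNReal.ofReal_lt_top).ne] with C hC
  exact finite_of_liminf_hitCount hC.ne

/-- As the endpoints are not in `C`, a point of the intersection is interior to `[a,b]`, so
finiteness isolates it in all of `C` and not merely in the truncated set. -/
theorem perfect_inter_Icc_eq_empty {C : Set ℝ} (hC : Perfect C) {a b : ℝ} (ha : a ∉ C)
    (hb : b ∉ C) (hfin : (C ∩ Set.Icc a b).Finite) : C ∩ Set.Icc a b = ∅ := by
  refine Set.eq_empty_of_forall_notMem fun x hx => ?_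
  have hacc := accPt_iff_frequently.1 (hC.acc x hx.1)
  have h1 : Set.Ioo a b ∈ nhds x := isOpen_Ioo.mem_nhds
    ⟨lt_of_le_of_ne hx.2.1 fun h => ha (h ▸ hx.1), lt_of_le_of_ne hx.2.2 fun h => hb (h ▸ hx.1)⟩
  have h2 : ((C ∩ Set.Icc a b) \ {x})ᶜ ∈ nhds x :=
    (hfin.subset Set.sdiff_subset).isClosed.isOpen_compl.mem_nhds (by simp)
  refine hacc ?_
  filter_upwards [h1, h2] with y hy hy' h
  exact hy' ⟨⟨h.2, Set.Ioo_subset_Icc_self hy⟩, h.1⟩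

end ClosedSets

namespace MeasureClass

/-! ### Spectral measures of half-densities -/

section SpectralMeasure

variable {𝕜 : Type*} [RCLike 𝕜] {X : Type*} [MeasurableSpace X] {M : MeasureClass X}

/-- The measure `|f|²·μ` for `ψ = f√μ`. The choice of `μ` is immaterial, see `spectral_eq`. -/
noncomputable def spectral (ψ : L2 𝕜 M) : Measure X :=
  (Classical.arbitrary M : Measure X).withDensity
    fun x => ‖L2.member (Classical.arbitrary M) ψ x‖ₑ ^ 2

theorem measurable_density (μ : M) (ψ : L2 𝕜 M) :
    Measurable fun x => ‖L2.member μ ψ x‖ₑ ^ 2 :=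
  (Lp.stronglyMeasurable (L2.member μ ψ)).measurable.enorm.pow_const 2

theorem enorm_transfer_sq {μ ν : Measure X} (f : X → 𝕜) {x : X} (hx : μ.rnDeriv ν x ≠ ∞) :
    ‖transfer μ ν f x‖ₑ ^ 2 = μ.rnDeriv ν x * ‖f x‖ₑ ^ 2 := by
  have h : ‖((Real.sqrt (μ.rnDeriv ν x).toReal : ℝ) : 𝕜)‖ₑ ^ 2 = μ.rnDeriv ν x := by
    rw [← ofReal_norm, RCLike.norm_ofReal, ← ENNReal.ofReal_pow (abs_nonneg _), sq_abs,
      Real.sq_sqrt ENNReal.toReal_nonneg, ENNReal.ofReal_toReal hx]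
  rw [transfer, enorm_mul, mul_pow, h]

/-- The factor `√(dμ/dν)` relating two members becomes the Radon–Nikodym derivative after squaring,
and this compensates the change of the reference measure. -/
theorem withDensity_member_eq (ψ : L2 𝕜 M) (μ ν : M) :
    (μ : Measure X).withDensity (fun x => ‖L2.member μ ψ x‖ₑ ^ 2) =
      (ν : Measure X).withDensity (fun x => ‖L2.member ν ψ x‖ₑ ^ 2) := by
  have key := withDensity_mul (ν : Measure X) (Measure.measurable_rnDeriv (μ : Measure X) ν)
    (measurable_density μ ψ)
  rw [Measure.withDensity_rnDeriv_eq _ _ (M.ac μ ν)] at key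
  rw [← key]
  refine withDensity_congr_ae (Filter.EventuallyEq.symm ?_)
  filter_upwards [L2.at_ae ψ μ ν, Measure.rnDeriv_ne_top (μ : Measure X) (ν : Measure X)]
    with x h1 h2
  rw [h1, enorm_transfer_sq _ h2, Pi.mul_apply]

theorem spectral_eq (ψ : L2 𝕜 M) (μ : M) :
    spectral ψ = (μ : Measure X).withDensity fun x => ‖L2.member μ ψ x‖ₑ ^ 2 :=
  withDensity_member_eq ψ _ μ

theorem spectral_ac (ψ : L2 𝕜 M) (μ : M) : spectral ψ ≪ (μ : Measure X) := by
  rw [spectral_eq ψ μ]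
  exact withDensity_absolutelyContinuous _ _

theorem spectral_ae (ψ : L2 𝕜 M) {P : X → Prop} (hP : M.AE P) : ∀ᵐ x ∂(spectral ψ), P x :=
  let μ := Classical.arbitrary M
  (spectral_ac ψ μ).ae_le (hP μ μ.2)

instance (ψ : L2 𝕜 M) : IsFiniteMeasure (spectral ψ) := by
  refine isFiniteMeasure_withDensity ?_
  -- The total mass is the square of the `L²` norm of the member.
  have h := (Lp.memLp (L2.member (Classical.arbitrary M) ψ)).eLpNorm_ne_top
  rw [Ne, eLpNorm_eq_lintegral_rpow_enorm_toReal (by norm_num) (by norm_num)] at h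
  intro h'
  apply h
  simp only [ENNReal.toReal_ofNat, ENNReal.rpow_ofNat, h']
  simp

theorem ae_member_of_spectral {ψ : L2 𝕜 M} (μ : M) {P : X → Prop}
    (h : ∀ᵐ x ∂(spectral ψ), P x) : ∀ᵐ x ∂(μ : Measure X), L2.member μ ψ x ≠ 0 → P x := by
  rw [spectral_eq ψ μ, ae_withDensity_iff (measurable_density μ ψ)] at h
  filter_upwards [h] with x hx h0
  exact hx (by simpa using h0)

variable {X₁ X₂ : Type*} [MeasurableSpace X₁] [MeasurableSpace X₂]
  {M₁ : MeasureClass X₁} {M₂ : MeasureClass X₂} {p₁ : X → X₁} {p₂ : X → X₂} {j : X₁ × X₂ → X}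

/-- The squared modulus of `f ⊗ g` is `|f|² ⊗ |g|²`, so the density factorizes along with the
reference measure. -/
theorem IsProduct.spectral_tmul (h : IsProduct M₁ M₂ M p₁ p₂ j) (ψ : L2 𝕜 M₁) (φ : L2 𝕜 M₂) :
    spectral (h.tmul ψ φ) = ((spectral ψ).prod (spectral φ)).map j := by
  let μ := Classical.arbitrary M₁
  let ν := Classical.arbitrary M₂
  rw [spectral_eq _ (h.pr μ ν), spectral_eq ψ μ, spectral_eq φ ν,
    prod_withDensity (measurable_density μ ψ) (measurable_density ν φ)]
  have hg : Measurable fun x => ‖L2.member μ ψ (p₁ x)‖ₑ ^ 2 * ‖L2.member ν φ (p₂ x)‖ₑ ^ 2 :=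
    ((measurable_density μ ψ).comp h.meas₁).mul ((measurable_density ν φ).comp h.meas₂)
  have e : (fun x => ‖L2.member (h.pr μ ν) (h.tmul ψ φ) x‖ₑ ^ 2) =ᵐ[(h.pr μ ν : Measure X)]
      fun x => ‖L2.member μ ψ (p₁ x)‖ₑ ^ 2 * ‖L2.member ν φ (p₂ x)‖ₑ ^ 2 := by
    filter_upwards [h.tmul_member ψ φ μ ν] with x hx
    rw [hx, enorm_mul, mul_pow]
  rw [withDensity_congr_ae e]
  change (Measure.map j _).withDensity _ = _
  rw [← map_withDensity_comp _ h.meas hg]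
  congr 1
  refine withDensity_congr_ae ?_
  filter_upwards [h.left_inv μ ν] with z hz
  simp [hz.1, hz.2]

theorem IsProduct.spectral_tmul_apply (h : IsProduct M₁ M₂ M p₁ p₂ j) (ψ : L2 𝕜 M₁)
    (φ : L2 𝕜 M₂) {A : Set X₁} {B : Set X₂} (hA : MeasurableSet A) (hB : MeasurableSet B) :
    spectral (h.tmul ψ φ) (p₁ ⁻¹' A ∩ p₂ ⁻¹' B) = spectral ψ A * spectral φ B := by
  let μ := Classical.arbitrary M₁
  let ν := Classical.arbitrary M₂
  rw [h.spectral_tmul, Measure.map_apply h.meas ((h.meas₁ hA).inter (h.meas₂ hB)),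
    ← Measure.prod_prod]
  refine measure_congr ?_
  -- That `j` inverts the two projections is known almost everywhere for `μ × ν`; absolute
  -- continuity carries it over to the product of spectral measures.
  filter_upwards [((spectral_ac ψ μ).prod (spectral_ac φ ν)).ae_le (h.left_inv μ ν)] with z hz
  refine propext ?_
  change (p₁ (j z) ∈ A ∧ p₂ (j z) ∈ B) ↔ (z.1 ∈ A ∧ z.2 ∈ B)
  rw [hz.1, hz.2]

/-- The factors of a product are independent under the spectral measure of a product vector. -/
theorem IsProduct.spectral_tmul_indep (h : IsProduct M₁ M₂ M p₁ p₂ j) (ψ : L2 𝕜 M₁)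
    (φ : L2 𝕜 M₂) {A : Set X₁} {B : Set X₂} (hA : MeasurableSet A) (hB : MeasurableSet B) :
    spectral (h.tmul ψ φ) Set.univ * spectral (h.tmul ψ φ) (p₁ ⁻¹' A ∩ p₂ ⁻¹' B) =
      spectral (h.tmul ψ φ) (p₁ ⁻¹' A) * spectral (h.tmul ψ φ) (p₂ ⁻¹' B) := by
  -- Spectral measures are not normalized, so independence carries an extra factor, the total mass.
  -- All four terms are values on rectangles.
  have h1 := h.spectral_tmul_apply ψ φ MeasurableSet.univ MeasurableSet.univ
  have h2 := h.spectral_tmul_apply ψ φ hA MeasurableSet.univ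
  have h3 := h.spectral_tmul_apply ψ φ MeasurableSet.univ hB
  simp only [Set.preimage_univ, Set.inter_univ, Set.univ_inter] at h1 h2 h3
  rw [h1, h2, h3, h.spectral_tmul_apply ψ φ hA hB]
  ring

end SpectralMeasure

/-! ### The vacuum vector and the concentration of decomposable vectors -/

section Decomposable

open ClosedSets

variable {M : MeasureClass (Closeds ℝ)} {𝕜 : Type*} [RCLike 𝕜]

/-- Positivity depends only on the null sets. At each concatenation point `s` one may therefore pass
to the probability measure of the class that makes the two sides of `s` independent. -/
theorem measure_miss_ne_zero (hM : M.IsDecomposable) {a b : ℝ} (hab : a ≤ b) (μ : M) :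
    (μ : Measure (Closeds ℝ)) (miss a b) ≠ 0 := by
  have hac : ∀ {ν : Measure (Closeds ℝ)} (hν : ν ∈ M.carrier) {S : Set (Closeds ℝ)},
      (μ : Measure (Closeds ℝ)) S ≠ 0 → ν S ≠ 0 :=
    fun hν _ h h0 => h (M.ac μ ⟨_, hν⟩ h0)
  refine interval_property_of_local (P := fun s t => (μ : Measure (Closeds ℝ)) (miss s t) ≠ 0)
    hab ?_ ?_ fun t => exists_measure_miss_ne_zero ?_ (hM.notMem t μ μ.2)
  · exact fun s t s' t' h1 h2 h h0 => h (measure_mono_null (miss_mono h1 h2) h0)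
  · intro s t has hst htb h1 h2
    obtain ⟨ν, hν, hp, hi⟩ := hM.indep s
    have e1 : MeasurableSet[fieldOn (leftRay s)] (miss a s) :=
      ⟨miss a s, measurableSet_miss _ _, by
        ext C; simp only [Set.mem_preimage, mem_miss]
        exact ⟨fun h x hx hx' => h x ⟨hx, hx'.2⟩ hx', fun h x hx => h x hx.1⟩⟩
    have e2 : MeasurableSet[fieldOn (rightRay s)] (miss s t) :=
      ⟨miss s t, measurableSet_miss _ _, by
        ext C; simp only [Set.mem_preimage, mem_miss]
        exact ⟨fun h x hx hx' => h x ⟨hx, hx'.1⟩ hx', fun h x hx => h x hx.1⟩⟩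
    have h3 := (ProbabilityTheory.Indep_iff _ _ _).1 hi _ _ e1 e2
    rw [miss_inter_miss has hst] at h3
    intro h0
    rw [M.ac ⟨ν, hν⟩ μ h0] at h3
    exact mul_ne_zero (hac hν h1) (hac hν h2) h3.symm
  · rintro h0
    -- Decomposability puts a probability measure into the class, so no member is zero.
    obtain ⟨ν, hν, hp, -⟩ := hM.indep 0
    have : ν Set.univ = 0 := M.ac ⟨ν, hν⟩ μ (by simp [h0])
    simp at this

theorem onSegment_singleton_bot_ne_zero (hM : M.IsDecomposable) {a b : ℝ} (hab : a ≤ b)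
    (μ : M.onSegment a b) : (μ : Measure (Closeds ℝ)) {⊥} ≠ 0 := by
  obtain ⟨_, μ, hμ, rfl⟩ := μ
  change μ.map _ _ ≠ 0
  rw [Measure.map_apply (measurable_inf_const _) measurableSet_singleton_bot]
  exact measure_miss_ne_zero hM hab ⟨μ, hμ⟩

/-- The half-density `1_{∅}√μ` for a chosen `μ`. -/
noncomputable def vacuum (𝕜 : Type*) [RCLike 𝕜] (N : MeasureClass (Closeds ℝ)) : L2 𝕜 N :=
  L2.mk (Classical.arbitrary N) (({⊥} : Set (Closeds ℝ)).indicator fun _ => (1 : 𝕜))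
    (memLp_indicator_const 2 measurableSet_singleton_bot 1 (Or.inr (measure_ne_top _ _)))

theorem vacuum_member (N : MeasureClass (Closeds ℝ)) :
    L2.member (Classical.arbitrary N) (vacuum 𝕜 N)
      =ᵐ[(Classical.arbitrary N : Measure (Closeds ℝ))]
        ({⊥} : Set (Closeds ℝ)).indicator fun _ => (1 : 𝕜) :=
  L2.mk_at_self _ _ _

theorem eq_bot_of_vacuum_member_ne_zero (N : MeasureClass (Closeds ℝ)) (μ : N) :
    ∀ᵐ C ∂(μ : Measure (Closeds ℝ)), L2.member μ (vacuum 𝕜 N) C ≠ 0 → C = ⊥ := by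
  filter_upwards [L2.mk_at (𝕜 := 𝕜) _ _ _ μ] with C hC h
  rw [vacuum, hC] at h
  by_contra hne
  simp [transfer, hne] at h

theorem vacuum_ne_zero {N : MeasureClass (Closeds ℝ)}
    (h : (Classical.arbitrary N : Measure (Closeds ℝ)) {⊥} ≠ 0) : vacuum 𝕜 N ≠ 0 := by
  intro h0
  have h1 := vacuum_member (𝕜 := 𝕜) N
  rw [h0, map_zero] at h1
  have h2 := (Lp.coeFn_zero 𝕜 2 _).symm.trans h1
  apply h
  rw [measure_eq_zero_iff_ae_notMem]
  filter_upwards [h2] with C hC hC'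
  rw [Set.mem_singleton_iff] at hC'
  simp [hC'] at hC

/-- A function vanishing almost everywhere off the single point `⊥` is determined by its value
there, which is the coefficient `c`. -/
theorem exists_eq_smul_vacuum {N : MeasureClass (Closeds ℝ)} (μ : N) {ψ : L2 𝕜 N}
    (h : ∀ᵐ C ∂(μ : Measure (Closeds ℝ)), L2.member μ ψ C ≠ 0 → C = ⊥) :
    ∃ c : 𝕜, ψ = c • vacuum 𝕜 N := by
  set μ₀ := Classical.arbitrary N with hμ₀
  refine ⟨L2.member μ₀ ψ ⊥, L2.ext_at μ₀ ?_⟩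
  rw [map_smul]
  filter_upwards [(N.ac μ₀ μ).ae_le h, L2.at_ae ψ μ μ₀, vacuum_member (𝕜 := 𝕜) N,
    Lp.coeFn_smul (L2.member μ₀ ψ ⊥) (L2.member μ₀ (vacuum 𝕜 N))] with C h1 h2 h3 h4
  rw [h4, Pi.smul_apply, h3]
  by_cases hC : C = ⊥
  · simp [hC]
  · have h5 : L2.member μ ψ C = 0 := by_contra fun h => hC (h1 h)
    rw [h2]
    simp [transfer, h5, hC]

/-- The tensor product of the two vacua lives on unions of two empty sets, hence is a multiple of
the vacuum. The multiple need not be 1, because each vacuum uses its own chosen measure; it is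
nonzero since the tensor product of nonzero vectors is nonzero, and it is absorbed into the first
factor. -/
theorem exists_tmul_eq_vacuum (hM : M.IsDecomposable) {r s t : ℝ} (hrs : r < s) (hst : s < t) :
    ∃ (ψ : L2 𝕜 (M.onSegment r s)) (φ : L2 𝕜 (M.onSegment s t)),
      vacuum 𝕜 (M.onSegment r t) = (hM.isProduct hrs hst).tensor ψ φ := by
  set P := hM.isProduct hrs hst
  set ψ := vacuum 𝕜 (M.onSegment r s)
  set φ := vacuum 𝕜 (M.onSegment s t)
  let μ := Classical.arbitrary (M.onSegment r s)
  let ν := Classical.arbitrary (M.onSegment s t)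
  obtain ⟨c, hc⟩ : ∃ c : 𝕜, P.tensor ψ φ = c • vacuum 𝕜 (M.onSegment r t) := by
    refine exists_eq_smul_vacuum (P.pr μ ν) ?_
    filter_upwards [P.tmul_member ψ φ μ ν,
      P.ae₁ μ ν (eq_bot_of_vacuum_member_ne_zero (𝕜 := 𝕜) _ μ),
      P.ae₂ μ ν (eq_bot_of_vacuum_member_ne_zero (𝕜 := 𝕜) _ ν),
      P.right_inv _ (P.pr μ ν).2] with C h1 h2 h3 h4 h
    have h' : L2.member μ ψ (C ⊓ seg r s) * L2.member ν φ (C ⊓ seg s t) ≠ 0 := h1 ▸ h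
    rw [← h4, h2 (left_ne_zero_of_mul h'), h3 (right_ne_zero_of_mul h'), sup_bot_eq]
  have hc0 : c ≠ 0 := by
    rintro rfl
    have h1 := P.inner_tensor ψ ψ φ φ
    rw [hc, zero_smul, inner_zero_left] at h1
    rcases mul_eq_zero.1 h1.symm with h | h <;> rw [inner_self_eq_zero] at h
    · exact vacuum_ne_zero (onSegment_singleton_bot_ne_zero hM hrs.le _) h
    · exact vacuum_ne_zero (onSegment_singleton_bot_ne_zero hM hst.le _) h
  refine ⟨c⁻¹ • ψ, φ, ?_⟩
  rw [map_smul, LinearMap.smul_apply, hc, smul_smul, inv_mul_cancel₀ hc0, one_smul]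

/-- Factorization of the probability of avoiding `[0,t]` under the spectral measure of a vector
that splits at `s`. -/
theorem spectral_miss_mul (hM : M.IsDecomposable) {s t : ℝ} (h0 : 0 < s) (h1 : s < 1)
    (hst : s ≤ t) (ht : t ≤ 1) (ψ : L2 𝕜 (M.onSegment 0 s)) (φ : L2 𝕜 (M.onSegment s 1)) :
    spectral ((hM.isProduct h0 h1).tmul ψ φ) Set.univ *
        spectral ((hM.isProduct h0 h1).tmul ψ φ) (miss 0 t) =
      spectral ((hM.isProduct h0 h1).tmul ψ φ) (miss 0 s) *
        spectral ((hM.isProduct h0 h1).tmul ψ φ) (miss s t) := by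
  have := (hM.isProduct h0 h1).spectral_tmul_indep ψ φ (measurableSet_miss 0 s)
    (measurableSet_miss s t)
  rwa [miss_inf_seg _ _ _ _ le_rfl le_rfl, miss_inf_seg _ _ _ _ le_rfl ht,
    miss_inter_miss h0.le hst] at this

/-- If almost all sets are perfect and `ψ` splits at every point of `(0,1)`, then `ψ` is
concentrated on the empty set. -/
theorem spectral_eq_bot (hM : M.IsDecomposable) (hperfect : M.AE fun C => Perfect (C : Set ℝ))
    (ψ : L2 𝕜 (M.onSegment 0 1))
    (hψ : ∀ s (h0 : 0 < s) (h1 : s < 1), ∃ (ψ' : L2 𝕜 (M.onSegment 0 s))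
      (ψ'' : L2 𝕜 (M.onSegment s 1)), ψ = (hM.isProduct h0 h1).tmul ψ' ψ'') :
    ∀ᵐ C ∂(spectral ψ), C = ⊥ := by
  have hfin := ae_finite_of_independent_pieces (spectral ψ)
    (fun t => spectral_ae ψ (hM.onSegment_notMem 0 1 t)) (by
      intro s t h0 h1 hst ht
      obtain ⟨ψ', ψ'', rfl⟩ := hψ s h0 h1
      exact spectral_miss_mul hM h0 h1 hst ht ψ' ψ'')
  obtain ⟨μ, hμ⟩ := M.nonempty
  have hp := measurable_inf_const (seg 0 1)
  let ν : M.onSegment 0 1 := ⟨_, map_mem _ hp hμ⟩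
  let g : Closeds ℝ → ℝ≥0∞ := fun C => ‖L2.member ν ψ C‖ₑ ^ 2
  -- Perfectness is assumed for `C`, not for its truncation to `[0,1]`. The spectral measure is
  -- therefore written as the image of a measure on untruncated sets, absolutely continuous with
  -- respect to `μ`, where perfectness and the absence of 0 and 1 are available.
  have e : spectral ψ = (μ.withDensity (g ∘ fun C => C ⊓ seg 0 1)).map fun C => C ⊓ seg 0 1 := by
    rw [spectral_eq ψ ν, map_withDensity_comp μ hp (measurable_density ν ψ)]
  rw [e] at hfin ⊢
  refine (ae_map_iff hp.aemeasurable measurableSet_singleton_bot).2 ?_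
  have hac := (withDensity_absolutelyContinuous μ (g ∘ fun C => C ⊓ seg 0 1)).ae_le
  filter_upwards [ae_of_ae_map hp.aemeasurable hfin, hac (hperfect μ hμ), hac (hM.notMem 0 μ hμ),
    hac (hM.notMem 1 μ hμ)] with C h1 h2 h3 h4
  have h5 := perfect_inter_Icc_eq_empty h2 h3 h4
    (h1.subset fun x hx => ⟨hx, hx.2⟩)
  exact SetLike.coe_injective h5

end Decomposable

end MeasureClass

/-! ### Determination of the type -/

theorem lemma5p8 (𝕜 : Type*) [RCLike 𝕜] (M : MeasureClass (Closeds ℝ)) (hM : M.IsDecomposable)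
    (hperfect : M.AE fun C => Perfect (C : Set ℝ))
    (hne : ¬ M.AE fun C => (C : Set ℝ) ∩ Set.Icc 0 1 = ∅) :
    (hM.cphs 𝕜).IsTypeII0 := by
  have hvac0 : MeasureClass.vacuum 𝕜 (M.onSegment 0 1) ≠ 0 := MeasureClass.vacuum_ne_zero
    (MeasureClass.onSegment_singleton_bot_ne_zero hM zero_le_one _)
  let Ω : (hM.cphs 𝕜).total := MeasureClass.vacuum 𝕜 (M.onSegment 0 1)
  have hΩ0 : Ω ≠ 0 := hvac0
  have hΩ : (hM.cphs 𝕜).IsDecomposableVector Ω :=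
    ⟨hΩ0, fun t h0 h1 => MeasureClass.exists_tmul_eq_vacuum hM h0 h1⟩
  have hline : ∀ ψ, (hM.cphs 𝕜).IsDecomposableVector ψ → ψ ∈ Submodule.span 𝕜 {Ω} := by
    rintro ψ ⟨-, hψ⟩
    have hψ' : ∀ s (h0 : 0 < s) (h1 : s < 1), ∃ (ψ' : MeasureClass.L2 𝕜 (M.onSegment 0 s))
        (ψ'' : MeasureClass.L2 𝕜 (M.onSegment s 1)), ψ = (hM.isProduct h0 h1).tmul ψ' ψ'' :=
      fun s h0 h1 => hψ ⟨s, h0.le, h1.le⟩ h0 h1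
    obtain ⟨c, hc⟩ := MeasureClass.exists_eq_smul_vacuum
      (Classical.arbitrary (M.onSegment 0 1)) (MeasureClass.ae_member_of_spectral _
        (MeasureClass.spectral_eq_bot hM hperfect ψ hψ'))
    exact Submodule.mem_span_singleton.2 ⟨c, hc.symm⟩
  refine ⟨⟨fun hI => hne fun μ hμ => ?_, fun hIII => hIII Ω hΩ⟩,
    Submodule.span 𝕜 {Ω}, finrank_span_singleton hΩ0, hline⟩
  have hclosed : IsClosed (Submodule.span 𝕜 {Ω} : Set (hM.cphs 𝕜).total) :=
    Submodule.closed_of_finiteDimensional _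
  -- Under type I the line through `Ω`, being closed and containing all decomposable vectors, is the
  -- whole space.
  have htop : (⊤ : Submodule 𝕜 (hM.cphs 𝕜).total) ≤ Submodule.span 𝕜 {Ω} := by
    rw [← show _ = ⊤ from hI]
    exact Submodule.topologicalClosure_minimal _ (Submodule.span_le.2 hline) hclosed
  obtain ⟨ν, hν⟩ : ∃ ν : M.onSegment 0 1,
      (ν : Measure (Closeds ℝ)) = μ.map fun C => C ⊓ MeasureClass.seg 0 1 :=
    ⟨⟨_, MeasureClass.map_mem _ (MeasureClass.measurable_inf_const _) hμ⟩, rfl⟩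
  -- The constant 1 vanishes nowhere, so it can be a multiple of the vacuum only if the empty set
  -- carries all of `ν`.
  let u : MeasureClass.L2 𝕜 (M.onSegment 0 1) :=
    MeasureClass.L2.mk ν (fun _ => (1 : 𝕜)) (memLp_const 1)
  obtain ⟨c, hc⟩ := Submodule.mem_span_singleton.1 (htop (x := u) trivial)
  have hc' : c • MeasureClass.vacuum 𝕜 (M.onSegment 0 1) = u := hc
  have hbot : ∀ᵐ C ∂(ν : Measure (Closeds ℝ)), C = ⊥ := by
    have h1 := MeasureClass.L2.mk_at_self ν (fun _ => (1 : 𝕜)) (memLp_const 1)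
    change MeasureClass.L2.member ν u =ᵐ[_] _ at h1
    rw [← hc', map_smul] at h1
    filter_upwards [h1, Lp.coeFn_smul c (MeasureClass.L2.member ν
        (MeasureClass.vacuum 𝕜 (M.onSegment 0 1))),
      MeasureClass.eq_bot_of_vacuum_member_ne_zero (𝕜 := 𝕜) (M.onSegment 0 1) ν] with C h1 h2 h3
    refine h3 fun h0 => ?_
    rw [h2, Pi.smul_apply, h0, smul_zero] at h1
    exact zero_ne_one h1
  rw [hν] at hbot
  filter_upwards [ae_of_ae_map (MeasureClass.measurable_inf_const _).aemeasurable hbot] with C hC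
  exact congrArg (fun K : Closeds ℝ => (K : Set ℝ)) hC
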